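/- Let $K\subset\mathbb{R}^n$ be a nonempty closed convex set (possibly unbounded) with diameter $d\in[0,\infty]$, let $\|\cdot\|$ be the Euclidean norm and $B(\theta,\varepsilon)$ the closed Euclidean ball. For $\mu\in K$ and $\sigma>0$ observe $Y=\mu+\xi$ with $\xi\sim N(0,\sigma^2\mathbb{I}_n)$, let $\hat\mu=\operatorname{argmin}_{\nu\in K}\|Y-\nu\|^2$ be the least squares estimator, and let $$\varepsilon_K(\sigma)=\Big(\sup_{\mu\in K}\mathbb{E}\|\hat\mu-\mu\|^2\Big)^{1/2}.$$ Let $w_\nu(\varepsilon)=\mathbb{E}\sup_{t\in B(\nu,\varepsilon)\cap K}\langle x,t\rangle$ with $x\sim N(0,\mathbb{I}_n)$ be the local Gaussian width. For a constant $c^*>1$ let $M^{\mathrm{loc}}(\varepsilon)=\sup_{\theta\in K}M(\varepsilon/c^*,B(\theta,\varepsilon)\cap K)$, where $M(\delta,T)$ is the largest cardinality of a subset of $T$ whose distinct points are at distance $>\delta$. Put $C=2[(2+1/c^*)^2-1/{c^*}^2]=8+8/c^*$ and, for a constant $L>0$, $$\overline\varepsilon(\sigma)=\sup\Big\{\varepsilon\ge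 0:\ \sup_{\nu_1,\nu_2\in K,\ \|\nu_1-\nu_2\|\le2\varepsilon}\big[w_{\nu_1}(\varepsilon/c^*)-w_{\nu_2}(\varepsilon/c^*)\big]-\frac{C\varepsilon^2}{2\sigma}+\frac{L}{c^*}\,\varepsilon\sqrt{\log M^{\mathrm{loc}}(\varepsilon)}\ \ge 0\Big\}.$$ Write $\sigma'=C\sigma/(1-1/{c^*}^2)$. **Theorem.** For every $c^*>1$ there is $L_0>0$ such that for every $L\ge L_0$ the following hold. 1. There are constants $A,\kappa>0$, depending only on $c^*$ and $L$, such that for all $n$, all nonempty closed convex $K\subset\mathbb{R}^n$ and all $\sigma>0$: if $\overline\varepsilon(\sigma)\ge A\sigma$, then $$\overline\varepsilon(\sigma)/c^*\le\kappa\,\varepsilon_K(\sigma)\qquad\text{and}\qquad \varepsilon_K(\sigma)\le\overline\varepsilon(\sigma').$$ 2. For every $B>0$ there are constants $\kappa_1,\kappa_2>0$, depending only on $c^*$, $L$ and $B$, such that for all $n$, all nonempty closed convex $K\subset\mathbb{R}^n$ and all $\sigma>0$: if $\overline\varepsilon(\sigma')\le B\sigma$, then $$\kappa_1(\sigma\wedge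 d)\le\varepsilon_K(\sigma)\le\kappa_2(\sigma\wedge d).$$ -/

import Mathlib

open MeasureTheory ProbabilityTheory
open scoped ENNReal NNReal

noncomputable section

/-- The Gaussian width `w(T) = 𝔼 sup_{t ∈ T} ⟨x, t⟩`, `x ∼ N(0, I_n)`. It is used only for bounded
nonempty `T`, where the supremum is a real number and the expectation exists. -/
def gaussianWidth {n : ℕ} (T : Set (EuclideanSpace ℝ (Fin n))) : ℝ :=
  ∫ x, sSup ((fun t => inner ℝ x t) '' T) ∂(stdGaussian (EuclideanSpace ℝ (Fin n)))

/-- The local Gaussian width `w_ν(ε) = w(B(ν, ε) ∩ K)`. -/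
def localWidth {n : ℕ} (K : Set (EuclideanSpace ℝ (Fin n))) (ν : EuclideanSpace ℝ (Fin n))
    (ε : ℝ) : ℝ :=
  gaussianWidth (Metric.closedBall ν ε ∩ K)

/-- `M^loc(ε) = sup_{θ ∈ K} M(ε / c, B(θ, ε) ∩ K)`, where `M(δ, T)` is the largest cardinality of
a subset of `T` whose distinct points are at distance `> δ`. -/
def localPacking {n : ℕ} (c : ℝ) (K : Set (EuclideanSpace ℝ (Fin n))) (ε : ℝ) : ℕ∞ :=
  ⨆ θ ∈ K, Metric.packingNumber (ε / c).toNNReal (Metric.closedBall θ ε ∩ K)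

/-- The local entropy `log M^loc(ε)`. (`M^loc(ε)` is finite for every `ε ≥ 0`, `c > 0`.) -/
def localEntropy {n : ℕ} (c : ℝ) (K : Set (EuclideanSpace ℝ (Fin n))) (ε : ℝ) : ℝ :=
  Real.log ((localPacking c K ε).toNat : ℝ)

/-- The least squares estimator: the minimizer of `‖y - ν‖²` over `ν ∈ K`. -/
def lse {n : ℕ} (K : Set (EuclideanSpace ℝ (Fin n))) (y : EuclideanSpace ℝ (Fin n)) :
    EuclideanSpace ℝ (Fin n) :=
  Classical.epsilon fun ν => ν ∈ K ∧ ∀ ν' ∈ K, ‖y - ν‖ ^ 2 ≤ ‖y - ν'‖ ^ 2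

/-- On a nonempty closed set the minimizer exists. -/
theorem lse_spec {n : ℕ} {K : Set (EuclideanSpace ℝ (Fin n))} (hne : K.Nonempty)
    (hcl : IsClosed K) (y : EuclideanSpace ℝ (Fin n)) :
    lse K y ∈ K ∧ ∀ ν' ∈ K, ‖y - lse K y‖ ^ 2 ≤ ‖y - ν'‖ ^ 2 := by
  have h : ∃ ν, ν ∈ K ∧ ∀ ν' ∈ K, ‖y - ν‖ ^ 2 ≤ ‖y - ν'‖ ^ 2 := by
    obtain ⟨ν, hν, h⟩ := hcl.exists_infDist_eq_dist hne y
    refine ⟨ν, hν, fun ν' hν' => ?_⟩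
    have := Metric.infDist_le_dist_of_mem (x := y) hν'
    rw [h, dist_eq_norm, dist_eq_norm] at this
    gcongr
  exact Classical.epsilon_spec h

/-- The risk `𝔼 ‖μ̂(Y) - μ‖²` of the least squares estimator at `μ`, where `Y = μ + σ x` with
`x ∼ N(0, I_n)`. -/
def lseRisk {n : ℕ} (K : Set (EuclideanSpace ℝ (Fin n))) (σ : ℝ)
    (μ : EuclideanSpace ℝ (Fin n)) : ℝ :=
  ∫ x, ‖lse K (μ + σ • x) - μ‖ ^ 2 ∂(stdGaussian (EuclideanSpace ℝ (Fin n)))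

/-- The worst case rate `ε_K(σ)`, the square root of `sup_{μ ∈ K} 𝔼 ‖μ̂ - μ‖²`. (The risks are
bounded by `n σ²` for closed convex `K`, bounded or not.) -/
def worstCaseRate {n : ℕ} (K : Set (EuclideanSpace ℝ (Fin n))) (σ : ℝ) : ℝ :=
  Real.sqrt (sSup (lseRisk K σ '' K))

/-- The constant `C = 2[(2 + 1/c)² - 1/c²] = 8 + 8/c`. -/
def widthConst (c : ℝ) : ℝ := 2 * ((2 + 1 / c) ^ 2 - (1 / c) ^ 2)

/-- The largest difference `w_{ν₁}(ε/c) - w_{ν₂}(ε/c)` of local widths over `ν₁, ν₂ ∈ K` with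
`‖ν₁ - ν₂‖ ≤ 2ε`. -/
def maxWidthGap {n : ℕ} (c : ℝ) (K : Set (EuclideanSpace ℝ (Fin n))) (ε : ℝ) : ℝ :=
  sSup {r : ℝ | ∃ ν₁ ∈ K, ∃ ν₂ ∈ K, ‖ν₁ - ν₂‖ ≤ 2 * ε ∧
    r = localWidth K ν₁ (ε / c) - localWidth K ν₂ (ε / c)}

/-- The quantity `ε̄(σ)`, the supremum of all `ε ≥ 0` at which the largest difference of local
widths is at least `C ε² / (2σ) - (L / c) ε √(log M^loc(ε))`. (The value `ε = 0` always qualifies,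
so that `ε̄(σ) = 0` for a one-point set.) -/
def epsBar {n : ℕ} (c L : ℝ) (K : Set (EuclideanSpace ℝ (Fin n))) (σ : ℝ) : ℝ :=
  sSup {ε : ℝ | 0 ≤ ε ∧
    0 ≤ maxWidthGap c K ε - widthConst c * ε ^ 2 / (2 * σ)
      + L / c * ε * Real.sqrt (localEntropy c K ε)}

/-- `σ ∧ d` with `d ∈ [0, ∞]` the diameter of `K`, for `σ ≥ 0`. -/
def minDiam {n : ℕ} (K : Set (EuclideanSpace ℝ (Fin n))) (σ : ℝ) : ℝ :=
  (min (ENNReal.ofReal σ) (Metric.ediam K)).toReal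

end

/-! Fix `μ ∈ K`, put `Z = ‖μ̂ - μ‖` and let `F(r)` be the supremum of `⟨x, t - μ⟩` over `t ∈ B(μ, r)
∩ K`. Convexity of `K` makes `F` concave, and the obtuse angle criterion for projections says that
`Z / σ` is a supergradient of `F` at `r = Z`. So `F` has slope at least `Z / σ` below `Z`
(`localSup_add_le`) and at most `Z / σ` above it (`localSup_le_add`). As functions of the noise, `Z`
is `σ`-Lipschitz and `F(r)` is `r`-Lipschitz. Gaussian concentration, with constants free of the
dimension, turns these pointwise facts into relations between risks and local widths once the radius
exceeds a constant times `σ`.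

Upper bound: if the risk at `μ` is `ε²`, then `w_μ(ε) - w_μ(ε/c)` is at least `(1 - 1/c²) ε² / (2σ)`
(`le_localWidth_sub`). Covering `B(μ, ε) ∩ K` by balls of radius `ε/c`, with the Gaussian maximal
inequality, bounds this increment by the width gap plus an entropy term (`localWidth_sub_le`). Hence
`ε` qualifies in the definition of `ε̄(σ')`.

Lower bound: if `ε` qualifies for `ε̄(σ)`, then the width gap or the entropy term is of order `ε² /
σ`. A large gap makes `F` grow by that order at some `μ`, which is incompatible with a small risk
there (`le_lseRisk_of_localWidth_sub`). A large entropy gives many separated points of `K`. Were all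
their risks small, the estimator would find each of them with probability bounded below, and a
change of measure to one common centre would give disjoint events of total mass above one
(`le_worstCaseRate_of_localEntropy`).

At noise level the two-point method gives the lower bound `σ ∧ d` up to a constant, and the diameter
bounds the loss trivially from above. -/

/-! ### Density, Cameron–Martin formula and exponential moments of the standard Gaussian. -/

section GaussianMeasure

variable {E : Type*} [NormedAddCommGroup E] [InnerProductSpace ℝ E] [FiniteDimensional ℝ E]
  [MeasurableSpace E] [BorelSpace E]

/-- The Lebesgue density of the standard Gaussian measure. -/
noncomputable def stdGaussianDensity (x : E) : ℝ :=
  ((Real.pi / (1 / 2)) ^ ((Module.finrank ℝ E : ℝ) / 2))⁻¹ * Real.exp (-(1 / 2) * ‖x‖ ^ 2)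

omit [FiniteDimensional ℝ E] [MeasurableSpace E] [BorelSpace E] in
theorem stdGaussianDensity_nonneg (x : E) : 0 ≤ stdGaussianDensity x := by
  unfold stdGaussianDensity; positivity

omit [FiniteDimensional ℝ E] [MeasurableSpace E] [BorelSpace E] in
theorem continuous_stdGaussianDensity : Continuous (stdGaussianDensity : E → ℝ) := by
  unfold stdGaussianDensity; fun_prop

theorem integrable_stdGaussianDensity : Integrable (stdGaussianDensity : E → ℝ) := by
  refine Integrable.const_mul ?_ _
  have h := GaussianFourier.integrable_cexp_neg_mul_sq_norm_add (V := E) (b := 1 / 2)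
    (by norm_num) 0 0
  refine h.norm.congr (.of_forall fun x => ?_)
  simp only [zero_mul, add_zero, Complex.norm_exp]
  congr 1
  rw [← Complex.ofReal_pow, Complex.re_mul_ofReal]
  norm_num

/-- Both sides have the same characteristic function. The density serves the translation formula and
transfers Lebesgue-a.e. differentiability to the Gaussian measure. -/
theorem stdGaussian_eq_withDensity :
    stdGaussian E = (volume : Measure E).withDensity
      fun x => ENNReal.ofReal (stdGaussianDensity x) := by
  have : IsFiniteMeasure ((volume : Measure E).withDensity
      fun x => ENNReal.ofReal (stdGaussianDensity x)) :=
    isFiniteMeasure_withDensity_ofReal integrable_stdGaussianDensity.2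
  refine Measure.ext_of_charFun ?_
  ext t
  rw [charFun_stdGaussian, charFun_apply, integral_withDensity_eq_integral_toReal_smul
    (continuous_stdGaussianDensity.measurable.ennreal_ofReal) (by simp)]
  have h := GaussianFourier.integral_cexp_neg_mul_sq_norm_add (V := E) (b := 1 / 2)
    (by norm_num) Complex.I t
  have hpos : (0 : ℝ) < (Real.pi / (1 / 2)) ^ ((Module.finrank ℝ E : ℝ) / 2) := by positivity
  have hc : ((Real.pi : ℂ) / (1 / 2)) ^ ((Module.finrank ℝ E : ℂ) / 2)
      = (((Real.pi / (1 / 2)) ^ ((Module.finrank ℝ E : ℝ) / 2) : ℝ) : ℂ) := by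
    rw [Complex.ofReal_cpow (by positivity)]
    push_cast
    rfl
  rw [hc] at h
  have key : ∀ x : E, (ENNReal.ofReal (stdGaussianDensity x)).toReal •
      Complex.exp (inner ℝ x t * Complex.I)
      = (((Real.pi / (1 / 2)) ^ ((Module.finrank ℝ E : ℝ) / 2) : ℝ) : ℂ)⁻¹ *
        Complex.exp (-(1 / 2) * (‖x‖ : ℂ) ^ 2 + Complex.I * (inner ℝ t x : ℝ)) := by
    intro x
    rw [ENNReal.toReal_ofReal (stdGaussianDensity_nonneg x), stdGaussianDensity,
      Complex.exp_add, Complex.real_smul, real_inner_comm]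
    push_cast
    ring_nf
  simp_rw [key]
  rw [integral_const_mul, h, ← mul_assoc, inv_mul_cancel₀ (by exact_mod_cast hpos.ne'), one_mul,
    Complex.I_sq]
  congr 1
  ring

theorem stdGaussian_absolutelyContinuous : stdGaussian E ≪ (volume : Measure E) := by
  rw [stdGaussian_eq_withDensity]
  exact withDensity_absolutelyContinuous _ _

theorem map_inner_stdGaussian (h : E) :
    (stdGaussian E).map (fun x => inner ℝ x h) = gaussianReal 0 (‖h‖₊ ^ 2) := by
  have h1 := IsGaussian.map_eq_gaussianReal (μ := stdGaussian E) (innerSL ℝ h)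
  rw [integral_strongDual_stdGaussian, variance_dual_stdGaussian, innerSL_apply_norm] at h1
  have h2 : (fun x : E => inner ℝ x h) = innerSL ℝ h := by
    ext x; simp [real_inner_comm]
  rw [h2, h1]
  congr 1
  ext
  simp

theorem integrable_exp_inner_stdGaussian (h : E) :
    Integrable (fun x => Real.exp (inner ℝ x h)) (stdGaussian E) := by
  have h1 := integrable_exp_mul_gaussianReal (μ := 0) (v := ‖h‖₊ ^ 2) 1
  rw [← map_inner_stdGaussian, integrable_map_measure (by fun_prop) (by fun_prop)] at h1
  simpa [Function.comp_def] using h1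

theorem integral_exp_inner_stdGaussian (h : E) :
    ∫ x, Real.exp (inner ℝ x h) ∂(stdGaussian E) = Real.exp (‖h‖ ^ 2 / 2) := by
  have h1 := mgf_gaussianReal (map_inner_stdGaussian h) 1
  simpa [mgf] using h1

/-- The Cameron–Martin formula. -/
theorem stdGaussian_preimage_add_right (h : E) {A : Set E} (hA : MeasurableSet A) :
    (stdGaussian E).real ((fun x => x + h) ⁻¹' A) =
      ∫ x in A, Real.exp (inner ℝ x h - ‖h‖ ^ 2 / 2) ∂(stdGaussian E) := by
  have hm : MeasurableSet ((fun x : E => x + h) ⁻¹' A) := hA.preimage (by fun_prop)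
  have h1 : (stdGaussian E).real ((fun x => x + h) ⁻¹' A)
      = ∫ x, A.indicator (fun y : E => stdGaussianDensity (y - h)) (x + h) := by
    rw [← integral_indicator_one hm, stdGaussian_eq_withDensity,
      integral_withDensity_eq_integral_toReal_smul
      (continuous_stdGaussianDensity.measurable.ennreal_ofReal) (by simp)]
    refine integral_congr_ae (.of_forall fun x => ?_)
    by_cases hx : x + h ∈ A
    · simp [Set.indicator, hx, ENNReal.toReal_ofReal (stdGaussianDensity_nonneg x)]
    · simp [Set.indicator, hx]
  rw [h1, integral_add_right_eq_self (fun x => A.indicator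
      (fun y : E => stdGaussianDensity (y - h)) x) h, ← integral_indicator hA]
  rw [stdGaussian_eq_withDensity, integral_withDensity_eq_integral_toReal_smul
      (continuous_stdGaussianDensity.measurable.ennreal_ofReal) (by simp)]
  refine integral_congr_ae (.of_forall fun x => ?_)
  by_cases hx : x ∈ A
  · simp only [Set.indicator, hx, if_true, ENNReal.toReal_ofReal (stdGaussianDensity_nonneg x)]
    rw [stdGaussianDensity, stdGaussianDensity, norm_sub_sq_real, smul_eq_mul, mul_assoc,
      ← Real.exp_add]
    congr 2
    ring
  · simp [Set.indicator, hx]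

/-- A quantitative form of the absolute continuity of translated Gaussian measures. -/
theorem stdGaussian_preimage_add_right_sq_le (h : E) {A : Set E} (hA : MeasurableSet A) :
    (stdGaussian E).real ((fun x => x + h) ⁻¹' A) ^ 2 ≤
      Real.exp (‖h‖ ^ 2) * (stdGaussian E).real A := by
  set p := (stdGaussian E).real ((fun x => x + h) ⁻¹' A) with hp
  have hp0 : 0 ≤ p := measureReal_nonneg
  rcases hp0.eq_or_lt with h0 | h0
  · rw [← h0, zero_pow two_ne_zero]
    exact mul_nonneg (Real.exp_nonneg _) measureReal_nonneg
  -- Cauchy–Schwarz in the form `w ≤ s/2 + w²/(2s)`. Since the second moment of the weight is `exp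
  -- ‖h‖²`, this `s` makes the last term `p/2`, which the left side absorbs.
  set s := Real.exp (‖h‖ ^ 2) / p with hs
  have hs0 : 0 < s := by positivity
  have hw2 : ∀ x : E, Real.exp (inner ℝ x h - ‖h‖ ^ 2 / 2) ^ 2
      = Real.exp (-‖h‖ ^ 2) * Real.exp (inner ℝ x ((2 : ℝ) • h)) := by
    intro x
    rw [← Real.exp_nat_mul, ← Real.exp_add, inner_smul_right]
    congr 1
    push_cast
    ring
  have hint : Integrable (fun x => Real.exp (inner ℝ x h - ‖h‖ ^ 2 / 2) ^ 2) (stdGaussian E) := by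
    simp_rw [hw2]
    exact (integrable_exp_inner_stdGaussian _).const_mul _
  have hval : ∫ x, Real.exp (inner ℝ x h - ‖h‖ ^ 2 / 2) ^ 2 ∂(stdGaussian E)
      = Real.exp (‖h‖ ^ 2) := by
    simp_rw [hw2]
    rw [integral_const_mul, integral_exp_inner_stdGaussian, ← Real.exp_add, norm_smul]
    congr 1
    rw [Real.norm_ofNat]
    ring
  have hle : p ≤ s / 2 * (stdGaussian E).real A + Real.exp (‖h‖ ^ 2) / (2 * s) := by
    have e1 : p = ∫ x in A, Real.exp (inner ℝ x h - ‖h‖ ^ 2 / 2) ∂(stdGaussian E) :=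
      stdGaussian_preimage_add_right h hA
    have i2 : IntegrableOn (fun x : E => Real.exp (inner ℝ x h - ‖h‖ ^ 2 / 2)) A
        (stdGaussian E) := by
      simp_rw [Real.exp_sub]
      exact ((integrable_exp_inner_stdGaussian h).div_const _).integrableOn
    have e2 : ∫ x in A, Real.exp (inner ℝ x h - ‖h‖ ^ 2 / 2) ∂(stdGaussian E) ≤
        ∫ x in A, (s / 2 + Real.exp (inner ℝ x h - ‖h‖ ^ 2 / 2) ^ 2 / (2 * s))
          ∂(stdGaussian E) := by
      refine integral_mono i2 ((integrable_const _).add (hint.div_const _).integrableOn) ?_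
      intro x
      dsimp only
      set w := Real.exp (inner ℝ x h - ‖h‖ ^ 2 / 2)
      have : s / 2 + w ^ 2 / (2 * s) - w = (s - w) ^ 2 / (2 * s) := by field_simp; ring
      have h3 : 0 ≤ (s - w) ^ 2 / (2 * s) := by positivity
      linarith
    have e3 : ∫ x in A, (s / 2 + Real.exp (inner ℝ x h - ‖h‖ ^ 2 / 2) ^ 2 / (2 * s))
          ∂(stdGaussian E) = s / 2 * (stdGaussian E).real A +
          ∫ x in A, Real.exp (inner ℝ x h - ‖h‖ ^ 2 / 2) ^ 2 / (2 * s) ∂(stdGaussian E) := by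
      rw [integral_add (integrable_const _) (hint.div_const _).integrableOn]
      simp [mul_comm]
    have e4 : ∫ x in A, Real.exp (inner ℝ x h - ‖h‖ ^ 2 / 2) ^ 2 / (2 * s) ∂(stdGaussian E)
        ≤ Real.exp (‖h‖ ^ 2) / (2 * s) := by
      rw [← hval, ← integral_div]
      exact setIntegral_le_integral (hint.div_const _) (.of_forall fun x => by positivity)
    linarith
  have h5 : Real.exp (‖h‖ ^ 2) / (2 * s) = p / 2 := by
    rw [hs]; field_simp
  rw [h5] at hle
  have h6 : p / 2 ≤ s / 2 * (stdGaussian E).real A := by linarith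
  have h7 : s * p = Real.exp (‖h‖ ^ 2) := by rw [hs]; field_simp
  calc p ^ 2 = 2 * p * (p / 2) := by ring
    _ ≤ 2 * p * (s / 2 * (stdGaussian E).real A) := by gcongr
    _ = s * p * (stdGaussian E).real A := by ring
    _ = _ := by rw [h7]

/-- Fernique's theorem and `a‖x‖ ≤ a²/(4C) + C‖x‖²`. Exponentials of this kind are the dominating
functions in the Maurey–Pisier argument. -/
theorem integrable_exp_mul_norm_stdGaussian (a : ℝ) :
    Integrable (fun x => Real.exp (a * ‖x‖)) (stdGaussian E) := by
  obtain ⟨C, hC, hint⟩ := IsGaussian.exists_integrable_exp_sq (stdGaussian E)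
  refine (hint.const_mul (Real.exp (a ^ 2 / (4 * C)))).mono' (by fun_prop)
    (.of_forall fun x => ?_)
  rw [Real.norm_of_nonneg (by positivity), ← Real.exp_add]
  gcongr
  have : a ^ 2 / (4 * C) + C * ‖x‖ ^ 2 - a * ‖x‖ = (a - 2 * C * ‖x‖) ^ 2 / (4 * C) := by
    field_simp; ring
  have h3 : 0 ≤ (a - 2 * C * ‖x‖) ^ 2 / (4 * C) := by positivity
  linarith

theorem integrable_norm_stdGaussian : Integrable (fun x : E => ‖x‖) (stdGaussian E) :=
  (IsGaussian.integrable_id (μ := stdGaussian E)).norm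

theorem integrable_norm_sq_stdGaussian : Integrable (fun x : E => ‖x‖ ^ 2) (stdGaussian E) :=
  (IsGaussian.memLp_two_id (μ := stdGaussian E)).integrable_norm_pow (by simp)

end GaussianMeasure

/-! ### Dimension-free concentration of Lipschitz functions and the maximal inequality. -/

section Concentration

variable {E : Type*} [NormedAddCommGroup E] [InnerProductSpace ℝ E] [FiniteDimensional ℝ E]
  [MeasurableSpace E] [BorelSpace E]

theorem integrable_exp_mul_norm_mul_exp_mul_norm (a b : ℝ) :
    Integrable (fun p : E × E => Real.exp (a * ‖p.1‖) * Real.exp (b * ‖p.2‖))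
      ((stdGaussian E).prod (stdGaussian E)) :=
  (integrable_exp_mul_norm_stdGaussian a).mul_prod (integrable_exp_mul_norm_stdGaussian b)

omit [InnerProductSpace ℝ E] [FiniteDimensional ℝ E] [MeasurableSpace E] [BorelSpace E] in
theorem LipschitzWith.sub_le_mul_norm {f : E → ℝ} {l : ℝ≥0} (hf : LipschitzWith l f) (x y : E) :
    |f x - f y| ≤ l * ‖x - y‖ := by
  simpa [Real.dist_eq, dist_eq_norm] using hf.dist_le_mul x y

theorem integrable_exp_sub_prod {f : E → ℝ} {l : ℝ≥0} (hf : LipschitzWith l f) :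
    Integrable (fun p : E × E => Real.exp (f p.1 - f p.2))
      ((stdGaussian E).prod (stdGaussian E)) := by
  have hc := hf.continuous
  refine (integrable_exp_mul_norm_mul_exp_mul_norm (l : ℝ) (l : ℝ)).mono'
    (by fun_prop) (.of_forall fun p => ?_)
  rw [Real.norm_of_nonneg (by positivity), ← Real.exp_add]
  gcongr
  have h1 := (le_abs_self _).trans (hf.sub_le_mul_norm p.1 p.2)
  have h2 := norm_sub_le p.1 p.2
  nlinarith [l.coe_nonneg]

theorem measurePreserving_rotation_stdGaussian (θ : ℝ) :
    MeasurePreserving (ContinuousLinearMap.rotation θ : E × E → E × E)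
      ((stdGaussian E).prod (stdGaussian E)) ((stdGaussian E).prod (stdGaussian E)) :=
  ⟨by fun_prop, IsGaussian.map_rotation_eq_self_of_forall_strongDual_eq_zero
    (fun L => integral_strongDual_stdGaussian L) θ⟩

-- The bound is uniform in `N`: `N + 1` steps of angle `δ` add up to `π/2 ≤ 2`. It provides the
-- domination for the limit `N → ∞`.
omit [FiniteDimensional ℝ E] [MeasurableSpace E] [BorelSpace E] in
theorem abs_mul_sub_rotation_le {f : E → ℝ} {l : ℝ≥0} (hf : LipschitzWith l f) (N : ℕ)
    (p : E × E) :
    |(N + 1 : ℝ) * (f p.1 - f (Real.cos (Real.pi / 2 / (N + 1)) • p.1 +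
      Real.sin (Real.pi / 2 / (N + 1)) • p.2))| ≤ 2 * l * ‖p.1‖ + 2 * l * ‖p.2‖ := by
  set δ := Real.pi / 2 / (N + 1 : ℝ) with hδ
  have hN : (0 : ℝ) < N + 1 := by positivity
  have hδ0 : 0 ≤ δ := by positivity
  have hNδ : (N + 1 : ℝ) * δ ≤ 2 := by
    rw [hδ, mul_div_cancel₀ _ hN.ne']
    linarith [Real.pi_le_four]
  have hδ2 : δ ≤ 2 := by nlinarith
  have hcos : 1 - Real.cos δ ≤ δ := by
    nlinarith [Real.one_sub_sq_div_two_le_cos (x := δ)]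
  have hsin : |Real.sin δ| ≤ δ := by
    simpa [abs_of_nonneg hδ0] using Real.abs_sin_le_abs (x := δ)
  have hn : ‖p.1 - (Real.cos δ • p.1 + Real.sin δ • p.2)‖ ≤ δ * ‖p.1‖ + δ * ‖p.2‖ := by
    have : p.1 - (Real.cos δ • p.1 + Real.sin δ • p.2)
      = (1 - Real.cos δ) • p.1 - Real.sin δ • p.2 := by module
    rw [this]
    refine (norm_sub_le _ _).trans ?_
    rw [norm_smul, norm_smul, Real.norm_eq_abs, Real.norm_eq_abs,
      abs_of_nonneg (sub_nonneg.2 (Real.cos_le_one δ))]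
    gcongr
  have h1 := hf.sub_le_mul_norm p.1 (Real.cos δ • p.1 + Real.sin δ • p.2)
  rw [abs_mul, abs_of_pos hN]
  calc (N + 1 : ℝ) * |f p.1 - f (Real.cos δ • p.1 + Real.sin δ • p.2)|
      ≤ (N + 1) * (l * (δ * ‖p.1‖ + δ * ‖p.2‖)) := by gcongr; exact h1.trans (by gcongr)
    _ = (N + 1) * δ * (l * (‖p.1‖ + ‖p.2‖)) := by ring
    _ ≤ 2 * (l * (‖p.1‖ + ‖p.2‖)) := by gcongr
    _ = _ := by ring

theorem integrable_exp_mul_sub_rotation {f : E → ℝ} {l : ℝ≥0} (hf : LipschitzWith l f) (N : ℕ) :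
    Integrable (fun p : E × E => Real.exp ((N + 1 : ℝ) * (f p.1 -
      f (Real.cos (Real.pi / 2 / (N + 1)) • p.1 + Real.sin (Real.pi / 2 / (N + 1)) • p.2))))
      ((stdGaussian E).prod (stdGaussian E)) := by
  have hc := hf.continuous
  refine (integrable_exp_mul_norm_mul_exp_mul_norm (2 * l : ℝ) (2 * l : ℝ)).mono'
    (by fun_prop) (.of_forall fun p => ?_)
  rw [Real.norm_of_nonneg (by positivity), ← Real.exp_add]
  gcongr
  exact (le_abs_self _).trans (abs_mul_sub_rotation_le hf N p)

/-- Splitting the quarter rotation from `x` to `y` into `N + 1` equal steps. -/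
theorem integral_exp_sub_le_integral_rotation {f : E → ℝ} {l : ℝ≥0} (hf : LipschitzWith l f)
    (N : ℕ) :
    ∫ p : E × E, Real.exp (f p.1 - f p.2) ∂((stdGaussian E).prod (stdGaussian E)) ≤
      ∫ p : E × E, Real.exp ((N + 1 : ℝ) * (f p.1 -
        f (Real.cos (Real.pi / 2 / (N + 1)) • p.1 + Real.sin (Real.pi / 2 / (N + 1)) • p.2)))
        ∂((stdGaussian E).prod (stdGaussian E)) := by
  set δ := Real.pi / 2 / (N + 1 : ℝ) with hδ
  set H : E × E → ℝ := fun p => Real.exp ((N + 1 : ℝ) * (f p.1 -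
      f (Real.cos δ • p.1 + Real.sin δ • p.2))) with hH
  have hHi : Integrable H ((stdGaussian E).prod (stdGaussian E)) :=
    integrable_exp_mul_sub_rotation hf N
  have hN : (0 : ℝ) < N + 1 := by positivity
  have hrot : ∀ k : ℕ, ∀ p : E × E, H (ContinuousLinearMap.rotation (k * δ) p) =
      Real.exp ((N + 1 : ℝ) * (f (Real.cos (k * δ) • p.1 + Real.sin (k * δ) • p.2) -
        f (Real.cos ((k + 1 : ℕ) * δ) • p.1 + Real.sin ((k + 1 : ℕ) * δ) • p.2))) := by
    intro k p
    simp only [hH, ContinuousLinearMap.rotation_apply]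
    congr 4
    push_cast
    rw [add_mul, one_mul, Real.cos_add, Real.sin_add]
    module
  have hpt : ∀ p : E × E, Real.exp (f p.1 - f p.2) ≤
      ∑ k ∈ Finset.range (N + 1), (N + 1 : ℝ)⁻¹ * H (ContinuousLinearMap.rotation (k * δ) p) := by
    intro p
    -- Jensen for the average of the increments scaled by `N + 1`; their sum telescopes along the
    -- arc from `x` to `y`. By rotation invariance all the terms have the same expectation.
    have hconv := convexOn_exp.map_sum_le (t := Finset.range (N + 1))
      (w := fun _ => (N + 1 : ℝ)⁻¹)
      (p := fun k => (N + 1 : ℝ) * (f (Real.cos (k * δ) • p.1 + Real.sin (k * δ) • p.2) -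
        f (Real.cos ((k + 1 : ℕ) * δ) • p.1 + Real.sin ((k + 1 : ℕ) * δ) • p.2)))
      (fun _ _ => by positivity) (by simp; field_simp) (fun _ _ => Set.mem_univ _)
    simp only [smul_eq_mul] at hconv
    simp_rw [inv_mul_cancel_left₀ hN.ne'] at hconv
    rw [Finset.sum_range_sub'] at hconv
    have hq : ((N + 1 : ℕ) : ℝ) * δ = Real.pi / 2 := by
      rw [hδ]; push_cast; field_simp
    rw [hq] at hconv
    simp only [Nat.cast_zero, zero_mul, Real.cos_zero, Real.sin_zero, one_smul, zero_smul,
      add_zero, Real.cos_pi_div_two, Real.sin_pi_div_two, zero_add] at hconv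
    simp_rw [hrot]
    exact hconv
  have hint : ∀ k : ℕ, Integrable (fun p => H (ContinuousLinearMap.rotation (k * δ) p))
      ((stdGaussian E).prod (stdGaussian E)) := fun k =>
    (measurePreserving_rotation_stdGaussian (k * δ)).integrable_comp_of_integrable hHi
  have hval : ∀ k : ℕ, ∫ p, H (ContinuousLinearMap.rotation (k * δ) p)
      ∂((stdGaussian E).prod (stdGaussian E)) = ∫ p, H p
      ∂((stdGaussian E).prod (stdGaussian E)) := by
    intro k
    have h := (measurePreserving_rotation_stdGaussian (E := E) (k * δ)).map_eq
    nth_rewrite 2 [← h]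
    rw [integral_map (by fun_prop) (by rw [h]; exact hHi.1)]
  calc ∫ p : E × E, Real.exp (f p.1 - f p.2) ∂((stdGaussian E).prod (stdGaussian E))
      ≤ ∫ p, ∑ k ∈ Finset.range (N + 1),
          (N + 1 : ℝ)⁻¹ * H (ContinuousLinearMap.rotation (k * δ) p)
          ∂((stdGaussian E).prod (stdGaussian E)) :=
        integral_mono (integrable_exp_sub_prod hf)
          (integrable_finsetSum _ fun k _ => (hint k).const_mul _) hpt
    _ = ∑ k ∈ Finset.range (N + 1), (N + 1 : ℝ)⁻¹ *
          ∫ p, H p ∂((stdGaussian E).prod (stdGaussian E)) := by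
        rw [integral_finsetSum _ fun k _ => (hint k).const_mul _]
        simp_rw [integral_const_mul, hval]
    _ = ∫ p, H p ∂((stdGaussian E).prod (stdGaussian E)) := by
        rw [Finset.sum_const, Finset.card_range, nsmul_eq_mul]
        push_cast
        field_simp

-- Only differentiability at the starting point of the arc enters, so Rademacher's theorem is enough
-- for Lipschitz `f`.
omit [FiniteDimensional ℝ E] [MeasurableSpace E] [BorelSpace E] in
theorem tendsto_mul_sub_rotation {f : E → ℝ} {x : E} (hx : DifferentiableAt ℝ f x) (y : E) :
    Filter.Tendsto (fun N : ℕ => (N + 1 : ℝ) * (f x -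
        f (Real.cos (Real.pi / 2 / (N + 1)) • x + Real.sin (Real.pi / 2 / (N + 1)) • y)))
      Filter.atTop (nhds (fderiv ℝ f x (-(Real.pi / 2) • y))) := by
  have hg : HasDerivAt (fun t : ℝ => f (Real.cos t • x + Real.sin t • y)) (fderiv ℝ f x y) 0 := by
    have h1 : HasDerivAt (fun t : ℝ => Real.cos t • x + Real.sin t • y) y 0 := by
      have := ((Real.hasDerivAt_cos 0).smul_const x).add ((Real.hasDerivAt_sin 0).smul_const y)
      simp only [Real.sin_zero, neg_zero, zero_smul, Real.cos_zero, one_smul, zero_add] at this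
      exact this
    have h2 : HasFDerivAt f (fderiv ℝ f x) (Real.cos 0 • x + Real.sin 0 • y) := by
      simpa using hx.hasFDerivAt
    exact h2.comp_hasDerivAt (0 : ℝ) h1
  have hs := hg.tendsto_slope
  have ht : Filter.Tendsto (fun N : ℕ => Real.pi / 2 / (N + 1 : ℝ)) Filter.atTop
      (nhdsWithin 0 {0}ᶜ) := by
    refine tendsto_nhdsWithin_iff.2 ⟨?_, .of_forall fun N => ?_⟩
    · have := (tendsto_one_div_add_atTop_nhds_zero_nat (𝕜 := ℝ)).const_mul (Real.pi / 2)
      simpa [div_eq_mul_inv] using this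
    · have : 0 < Real.pi / 2 / (N + 1 : ℝ) := by positivity
      exact this.ne'
  have h := ((hs.comp ht).const_mul (-(Real.pi / 2)))
  rw [map_smul, smul_eq_mul]
  refine h.congr fun N => ?_
  have hN : (N + 1 : ℝ) ≠ 0 := by positivity
  have hpi := Real.pi_pos.ne'
  simp only [Function.comp, slope_def_field, Real.cos_zero, Real.sin_zero, one_smul, zero_smul,
    add_zero, sub_zero]
  field_simp
  ring

/-- The Maurey–Pisier inequality for Lipschitz functions of a Gaussian vector. -/
theorem integral_exp_sub_le {f : E → ℝ} {l : ℝ≥0} (hf : LipschitzWith l f) :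
    ∫ p : E × E, Real.exp (f p.1 - f p.2) ∂((stdGaussian E).prod (stdGaussian E)) ≤
      Real.exp (2 * (l : ℝ) ^ 2) := by
  have hc := hf.continuous
  have hdiff : ∀ᵐ p : E × E ∂((stdGaussian E).prod (stdGaussian E)),
      DifferentiableAt ℝ f p.1 :=
    Measure.quasiMeasurePreserving_fst.ae
      (stdGaussian_absolutelyContinuous.ae_le (hf.ae_differentiableAt (μ := volume)))
  have hbound : ∀ N : ℕ, ∀ᵐ p : E × E ∂((stdGaussian E).prod (stdGaussian E)),
      ‖Real.exp ((N + 1 : ℝ) * (f p.1 -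
        f (Real.cos (Real.pi / 2 / (N + 1)) • p.1 + Real.sin (Real.pi / 2 / (N + 1)) • p.2)))‖ ≤
      Real.exp (2 * l * ‖p.1‖) * Real.exp (2 * l * ‖p.2‖) := by
    refine fun N => .of_forall fun p => ?_
    rw [Real.norm_of_nonneg (by positivity), ← Real.exp_add]
    gcongr
    exact (le_abs_self _).trans (abs_mul_sub_rotation_le hf N p)
  have hlim : ∀ᵐ p : E × E ∂((stdGaussian E).prod (stdGaussian E)),
      Filter.Tendsto (fun N : ℕ => Real.exp ((N + 1 : ℝ) * (f p.1 -
        f (Real.cos (Real.pi / 2 / (N + 1)) • p.1 + Real.sin (Real.pi / 2 / (N + 1)) • p.2))))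
      Filter.atTop (nhds (Real.exp (fderiv ℝ f p.1 (-(Real.pi / 2) • p.2)))) := by
    filter_upwards [hdiff] with p hp
    exact (Real.continuous_exp.tendsto _).comp (tendsto_mul_sub_rotation hp p.2)
  have hbi := integrable_exp_mul_norm_mul_exp_mul_norm (E := E) (2 * l : ℝ) (2 * l : ℝ)
  have hconv := tendsto_integral_of_dominated_convergence _
    (fun N => (integrable_exp_mul_sub_rotation hf N).1) hbi hbound hlim
  have hle := ge_of_tendsto' hconv (integral_exp_sub_le_integral_rotation hf)
  refine hle.trans ?_
  have hint : Integrable (fun p : E × E => Real.exp (fderiv ℝ f p.1 (-(Real.pi / 2) • p.2)))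
      ((stdGaussian E).prod (stdGaussian E)) := by
    refine hbi.mono' (aestronglyMeasurable_of_tendsto_ae _
      (fun N => (integrable_exp_mul_sub_rotation hf N).1) hlim) ?_
    filter_upwards [hlim, ae_all_iff.2 hbound] with p hp hb
    exact le_of_tendsto' hp.norm hb
  rw [integral_prod _ hint]
  -- For fixed `x` the exponent is linear in the independent Gaussian `y`, with variance `(π/2)²
  -- ‖∇f(x)‖² ≤ 4 l²` by `π ≤ 4`.
  have hin : ∀ x : E, ∫ y, Real.exp (fderiv ℝ f x (-(Real.pi / 2) • y)) ∂(stdGaussian E) ≤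
      Real.exp (2 * (l : ℝ) ^ 2) := by
    intro x
    set g := (InnerProductSpace.toDual ℝ E).symm (fderiv ℝ f x) with hg
    have h1 : ∀ y : E, fderiv ℝ f x (-(Real.pi / 2) • y) = inner ℝ y (-(Real.pi / 2) • g) := by
      intro y
      rw [real_inner_comm, inner_smul_left, hg, InnerProductSpace.toDual_symm_apply, map_smul]
      simp
    simp_rw [h1]
    rw [integral_exp_inner_stdGaussian]
    gcongr
    have h2 : ‖g‖ ≤ l := by
      rw [hg, LinearIsometryEquiv.norm_map]
      exact norm_fderiv_le_of_lipschitz ℝ hf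
    have h3 : ‖-(Real.pi / 2) • g‖ ≤ 2 * l := by
      rw [norm_smul, norm_neg, Real.norm_of_nonneg (by positivity)]
      have := Real.pi_le_four
      gcongr
      linarith
    calc ‖-(Real.pi / 2) • g‖ ^ 2 / 2 ≤ (2 * l) ^ 2 / 2 := by gcongr
      _ = 2 * (l : ℝ) ^ 2 := by ring
  calc ∫ x, ∫ y, Real.exp (fderiv ℝ f x (-(Real.pi / 2) • y)) ∂(stdGaussian E) ∂(stdGaussian E)
      ≤ ∫ _x : E, Real.exp (2 * (l : ℝ) ^ 2) ∂(stdGaussian E) :=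
        integral_mono hint.integral_prod_left (integrable_const _) hin
    _ = _ := by simp

theorem LipschitzWith.integrable_stdGaussian {f : E → ℝ} {l : ℝ≥0} (hf : LipschitzWith l f) :
    Integrable f (stdGaussian E) := by
  refine ((integrable_norm_stdGaussian.const_mul (l : ℝ)).add (integrable_const |f 0|)).mono'
    hf.continuous.aestronglyMeasurable (.of_forall fun x => ?_)
  have h := hf.sub_le_mul_norm x 0
  rw [sub_zero] at h
  have h2 := abs_sub_abs_le_abs_sub (f x) (f 0)
  simp only [Pi.add_apply, Real.norm_eq_abs]
  linarith

theorem LipschitzWith.integrable_exp_stdGaussian {f : E → ℝ} {l : ℝ≥0} (hf : LipschitzWith l f) :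
    Integrable (fun x => Real.exp (f x)) (stdGaussian E) := by
  have hc := hf.continuous
  refine ((integrable_exp_mul_norm_stdGaussian (l : ℝ)).const_mul (Real.exp |f 0|)).mono'
    (by fun_prop) (.of_forall fun x => ?_)
  have h := hf.sub_le_mul_norm x 0
  rw [sub_zero] at h
  rw [Real.norm_of_nonneg (by positivity), ← Real.exp_add]
  gcongr
  linarith [le_abs_self (f x - f 0), le_abs_self (f 0)]

/-- Lipschitz functions of a Gaussian vector are sub-Gaussian. -/
theorem LipschitzWith.integral_exp_sub_integral_le {f : E → ℝ} {l : ℝ≥0}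
    (hf : LipschitzWith l f) :
    ∫ x, Real.exp (f x - ∫ y, f y ∂(stdGaussian E)) ∂(stdGaussian E) ≤
      Real.exp (2 * (l : ℝ) ^ 2) := by
  set m := ∫ y, f y ∂(stdGaussian E) with hm
  have hi := integrable_exp_sub_prod hf
  refine le_trans ?_ (integral_exp_sub_le hf)
  rw [integral_prod _ hi]
  have hexp : Integrable (fun x => Real.exp (f x - m)) (stdGaussian E) := by
    simp_rw [Real.exp_sub]
    exact hf.integrable_exp_stdGaussian.div_const _
  refine integral_mono hexp hi.integral_prod_left fun x => ?_
  dsimp only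
  have hfi := hf.integrable_stdGaussian
  have hneg : Integrable (fun y => Real.exp (-f y)) (stdGaussian E) :=
    (LipschitzWith.neg hf).integrable_exp_stdGaussian
  -- Jensen in the second variable, `exp (-m) ≤ 𝔼 exp (-f)`, by the tangent line of `exp` at `-m`.
  have h1 : ∫ y, Real.exp (-m) * (1 + (m - f y)) ∂(stdGaussian E) ≤
      ∫ y, Real.exp (-f y) ∂(stdGaussian E) := by
    refine integral_mono ?_ hneg fun y => ?_
    · exact ((integrable_const _).add ((integrable_const _).sub hfi)).const_mul _
    · dsimp only
      have h2 := Real.add_one_le_exp (m - f y)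
      calc Real.exp (-m) * (1 + (m - f y)) ≤ Real.exp (-m) * Real.exp (m - f y) := by
            gcongr; linarith
        _ = Real.exp (-f y) := by rw [← Real.exp_add]; congr 1; ring
  have hmf : Integrable (fun y => m - f y) (stdGaussian E) := (integrable_const _).sub hfi
  rw [integral_const_mul, integral_add (integrable_const _) hmf,
    integral_sub (integrable_const _) hfi, ← hm] at h1
  simp only [integral_const, probReal_univ, one_smul, sub_self, add_zero, mul_one] at h1
  simp_rw [sub_eq_add_neg, Real.exp_add]
  rw [integral_const_mul]
  gcongr

theorem LipschitzWith.integrable_sq_sub_stdGaussian {f : E → ℝ} {l : ℝ≥0}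
    (hf : LipschitzWith l f) (a : ℝ) :
    Integrable (fun x => (f x - a) ^ 2) (stdGaussian E) := by
  have hc := hf.continuous
  have hdom : Integrable (fun x : E => 2 * (l : ℝ) ^ 2 * ‖x‖ ^ 2 + 2 * |f 0 - a| ^ 2)
      (stdGaussian E) := (integrable_norm_sq_stdGaussian.const_mul _).add (integrable_const _)
  refine hdom.mono' (by fun_prop) (.of_forall fun x => ?_)
  have h := hf.sub_le_mul_norm x 0
  rw [sub_zero] at h
  rw [Real.norm_of_nonneg (by positivity), ← sq_abs]
  have h2 : |f x - a| ≤ l * ‖x‖ + |f 0 - a| := by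
    have := abs_sub_le (f x) (f 0) a
    linarith
  calc |f x - a| ^ 2 ≤ (l * ‖x‖ + |f 0 - a|) ^ 2 := by gcongr
    _ ≤ _ := by nlinarith [sq_nonneg (l * ‖x‖ - |f 0 - a|)]

/-- A Poincaré-type inequality: an `l`-Lipschitz function has variance at most `16 l²`. -/
theorem LipschitzWith.integral_sq_sub_integral_le {f : E → ℝ} {l : ℝ≥0}
    (hf : LipschitzWith l f) (hl : 0 < l) :
    ∫ x, (f x - ∫ y, f y ∂(stdGaussian E)) ^ 2 ∂(stdGaussian E) ≤ 16 * (l : ℝ) ^ 2 := by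
  set m := ∫ y, f y ∂(stdGaussian E) with hm
  have hl' : (0 : ℝ) < l := hl
  have hg : LipschitzWith 1 (fun x => (l : ℝ)⁻¹ * f x) := by
    refine LipschitzWith.of_dist_le_mul fun x y => ?_
    rw [Real.dist_eq, ← mul_sub, abs_mul, abs_of_pos (by positivity), dist_eq_norm]
    have := hf.sub_le_mul_norm x y
    calc (l : ℝ)⁻¹ * |f x - f y| ≤ (l : ℝ)⁻¹ * (l * ‖x - y‖) := by gcongr
      _ = (1 : ℝ≥0) * ‖x - y‖ := by rw [inv_mul_cancel_left₀ hl'.ne']; simp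
  have hg' : LipschitzWith 1 (fun x => -((l : ℝ)⁻¹ * f x)) := LipschitzWith.neg hg
  have e1 := hg.integral_exp_sub_integral_le
  have e2 := hg'.integral_exp_sub_integral_le
  simp only [integral_neg, integral_const_mul, ← hm, NNReal.coe_one, one_pow, mul_one] at e1 e2
  have i1 : Integrable (fun x => Real.exp ((l : ℝ)⁻¹ * f x - (l : ℝ)⁻¹ * m)) (stdGaussian E) := by
    simp_rw [Real.exp_sub]
    exact hg.integrable_exp_stdGaussian.div_const _
  have i2 : Integrable (fun x => Real.exp (-((l : ℝ)⁻¹ * f x) - -((l : ℝ)⁻¹ * m)))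
      (stdGaussian E) := by
    simp_rw [Real.exp_sub]
    exact hg'.integrable_exp_stdGaussian.div_const _
  -- This is `s² ≤ 4 sinh²(s/2) = exp s + exp (-s) - 2`. Integration leaves `2e² - 2 ≤ 16`.
  have hpt : ∀ x, (f x - m) ^ 2 ≤ (l : ℝ) ^ 2 * (Real.exp ((l : ℝ)⁻¹ * f x - (l : ℝ)⁻¹ * m)
      + Real.exp (-((l : ℝ)⁻¹ * f x) - -((l : ℝ)⁻¹ * m)) - 2) := by
    intro x
    set s := (l : ℝ)⁻¹ * f x - (l : ℝ)⁻¹ * m with hs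
    have h1 : -((l : ℝ)⁻¹ * f x) - -((l : ℝ)⁻¹ * m) = -s := by rw [hs]; ring
    have h2 : (f x - m) ^ 2 = (l : ℝ) ^ 2 * s ^ 2 := by rw [hs]; field_simp
    rw [h1, h2]
    gcongr
    have h3 : (s / 2) ^ 2 ≤ Real.sinh (s / 2) ^ 2 := by
      rw [sq_le_sq, Real.abs_sinh]
      exact Real.self_le_sinh_iff.2 (abs_nonneg _)
    have h4 := Real.cosh_two_mul (s / 2)
    rw [Real.cosh_sq, mul_div_cancel₀ _ two_ne_zero, Real.cosh_eq] at h4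
    linarith
  have h4 := integral_mono (hf.integrable_sq_sub_stdGaussian m)
    (((i1.add i2).sub (integrable_const 2)).const_mul ((l : ℝ) ^ 2)) hpt
  simp only [Pi.add_apply, Pi.sub_apply] at h4
  have i3 : Integrable (fun x => Real.exp ((l : ℝ)⁻¹ * f x - (l : ℝ)⁻¹ * m)
      + Real.exp (-((l : ℝ)⁻¹ * f x) - -((l : ℝ)⁻¹ * m))) (stdGaussian E) := i1.add i2
  rw [integral_const_mul, integral_sub i3 (integrable_const 2), integral_add i1 i2] at h4
  simp only [integral_const, probReal_univ, one_smul] at h4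
  refine h4.trans ?_
  have h5 : Real.exp 2 ≤ 9 := by
    have h6 : Real.exp 2 = Real.exp 1 ^ 2 := by rw [← Real.exp_nat_mul]; norm_num
    rw [h6]
    have := Real.exp_one_lt_three
    nlinarith [Real.exp_pos 1]
  rw [mul_comm (16 : ℝ)]
  gcongr
  linarith

theorem LipschitzWith.integral_abs_sub_integral_le {f : E → ℝ} {l : ℝ≥0}
    (hf : LipschitzWith l f) (hl : 0 < l) :
    ∫ x, |f x - ∫ y, f y ∂(stdGaussian E)| ∂(stdGaussian E) ≤ 4 * l := by
  set m := ∫ y, f y ∂(stdGaussian E) with hm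
  have hl' : (0 : ℝ) < l := hl
  have hi := hf.integrable_sq_sub_stdGaussian m
  have hpt : ∀ x, |f x - m| ≤ (8 * (l : ℝ))⁻¹ * (f x - m) ^ 2 + 2 * l := by
    intro x
    rw [← sq_abs (f x - m)]
    have : (8 * (l : ℝ))⁻¹ * |f x - m| ^ 2 + 2 * l - |f x - m|
      = (8 * (l : ℝ))⁻¹ * (|f x - m| - 4 * l) ^ 2 := by field_simp; ring
    have h2 : 0 ≤ (8 * (l : ℝ))⁻¹ * (|f x - m| - 4 * l) ^ 2 := by positivity
    linarith
  have h := integral_mono ((hf.integrable_stdGaussian.sub (integrable_const m)).abs)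
    ((hi.const_mul _).add (integrable_const _)) hpt
  simp only [Pi.add_apply] at h
  rw [integral_add (hi.const_mul _) (integrable_const _), integral_const_mul] at h
  simp only [integral_const, probReal_univ, one_smul] at h
  have h2 := hf.integral_sq_sub_integral_le hl
  rw [← hm] at h2
  calc _ ≤ _ := h
    _ ≤ (8 * (l : ℝ))⁻¹ * (16 * (l : ℝ) ^ 2) + 2 * l := by gcongr
    _ = 4 * l := by field_simp; ring

/-- The maximal inequality for finitely many Lipschitz functions of a Gaussian vector. -/
theorem integral_le_add_mul_sqrt_log_card {ι : Type*} (s : Finset ι) (hs : s.Nonempty)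
    {f : ι → E → ℝ} {l : ℝ≥0} (hl : 0 < l) (hf : ∀ i ∈ s, LipschitzWith l (f i))
    {g : E → ℝ} (hg : Integrable g (stdGaussian E)) {a : ℝ}
    (ha : ∀ i ∈ s, ∫ x, f i x ∂(stdGaussian E) ≤ a)
    (hgf : ∀ x, ∃ i ∈ s, g x ≤ f i x) :
    ∫ x, g x ∂(stdGaussian E) ≤ a + 3 * l * Real.sqrt (Real.log s.card) := by
  have hl' : (0 : ℝ) < l := hl
  have hcard : (1 : ℝ) ≤ s.card := by exact_mod_cast hs.card_pos
  have hlog : 0 ≤ Real.log s.card := Real.log_nonneg hcard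
  have hexp : ∀ t : ℝ, 0 < t → ∫ x, g x ∂(stdGaussian E) ≤
      a + (Real.log s.card / t + 2 * l ^ 2 * t) := by
    intro t ht
    -- `exp b` bounds the sum of the exponential moments. Comparing with the tangent line of `exp`
    -- at `b` gives `t (𝔼 g - a) ≤ b` without integrating `exp (t g)`.
    set b := Real.log s.card + 2 * (t * l) ^ 2 with hb
    have hft : ∀ i ∈ s, LipschitzWith (t.toNNReal * l) (fun x => t * f i x) := by
      intro i hi
      refine LipschitzWith.of_dist_le_mul fun x y => ?_
      have := (hf i hi).sub_le_mul_norm x y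
      rw [Real.dist_eq, ← mul_sub, abs_mul, abs_of_pos ht, dist_eq_norm, NNReal.coe_mul,
        Real.coe_toNNReal _ ht.le, mul_assoc]
      gcongr
    have hint : ∀ i ∈ s, Integrable (fun x => Real.exp (t * f i x -
        ∫ y, t * f i y ∂(stdGaussian E))) (stdGaussian E) := by
      intro i hi
      simp_rw [Real.exp_sub]
      exact (hft i hi).integrable_exp_stdGaussian.div_const _
    have hpt : ∀ x, Real.exp b * (1 + (t * (g x - a) - b)) ≤
        ∑ i ∈ s, Real.exp (t * f i x - ∫ y, t * f i y ∂(stdGaussian E)) := by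
      intro x
      obtain ⟨i, hi, hix⟩ := hgf x
      have h1 := Real.add_one_le_exp (t * (g x - a) - b)
      calc Real.exp b * (1 + (t * (g x - a) - b))
          ≤ Real.exp b * Real.exp (t * (g x - a) - b) := by gcongr; linarith
        _ = Real.exp (t * (g x - a)) := by rw [← Real.exp_add]; congr 1; ring
        _ ≤ Real.exp (t * f i x - ∫ y, t * f i y ∂(stdGaussian E)) := by
            rw [integral_const_mul, ← mul_sub]
            gcongr
            exact ha i hi
        _ ≤ _ := Finset.single_le_sum
            (f := fun i => Real.exp (t * f i x - ∫ y, t * f i y ∂(stdGaussian E)))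
            (fun i _ => (Real.exp_pos _).le) hi
    have hga : Integrable (fun x => t * (g x - a)) (stdGaussian E) :=
      (hg.sub (integrable_const a)).const_mul t
    have hgi : Integrable (fun x => t * (g x - a) - b) (stdGaussian E) :=
      hga.sub (integrable_const b)
    have h := integral_mono (((integrable_const (1 : ℝ)).add hgi).const_mul (Real.exp b))
      (integrable_finsetSum s hint) hpt
    simp only [Pi.add_apply] at h
    rw [integral_const_mul, integral_add (integrable_const _) hgi,
      integral_sub hga (integrable_const b),
      integral_const_mul, integral_sub hg (integrable_const a), integral_finsetSum s hint] at h
    simp only [integral_const, probReal_univ, one_smul] at h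
    have hsum : ∑ i ∈ s, ∫ x, Real.exp (t * f i x - ∫ y, t * f i y ∂(stdGaussian E))
        ∂(stdGaussian E) ≤ Real.exp b * 1 := by
      calc _ ≤ ∑ _i ∈ s, Real.exp (2 * (t * l) ^ 2) := by
            refine Finset.sum_le_sum fun i hi => ?_
            have := (hft i hi).integral_exp_sub_integral_le
            rwa [NNReal.coe_mul, Real.coe_toNNReal _ ht.le] at this
        _ = Real.exp b * 1 := by
            rw [Finset.sum_const, nsmul_eq_mul, hb, Real.exp_add, Real.exp_log (by linarith),
              mul_one]
    have h3 := le_of_mul_le_mul_left (h.trans hsum) (Real.exp_pos b)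
    have h4 : t * (∫ x, g x ∂(stdGaussian E) - a) ≤ b := by linarith
    have h5 : ∫ x, g x ∂(stdGaussian E) - a ≤ b / t := by
      rw [le_div_iff₀ ht]; linarith
    have h6 : b / t = Real.log s.card / t + 2 * l ^ 2 * t := by rw [hb]; field_simp
    linarith
  rcases hlog.eq_or_lt with h0 | h0
  · rw [← h0, Real.sqrt_zero, mul_zero, add_zero]
    -- With vanishing logarithm the optimal `t` is `0`, which is only approached.
    refine le_of_forall_pos_le_add fun δ hδ => ?_
    have h := hexp (δ / (2 * l ^ 2)) (by positivity)
    rw [← h0, zero_div, zero_add, mul_div_cancel₀ _ (by positivity)] at h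
    exact h
  · set q := Real.sqrt (Real.log s.card) with hq
    have hq0 : 0 < q := Real.sqrt_pos.2 h0
    have hq2 : Real.log s.card = q ^ 2 := (Real.sq_sqrt hlog).symm
    have h := hexp (q / l) (by positivity)
    rw [hq2] at h
    have h6 : q ^ 2 / (q / l) + 2 * l ^ 2 * (q / l) = 3 * l * q := by field_simp; ring
    linarith

end Concentration

/-! ### Geometry of the projection, local support functions and their concavity. -/

section LeastSquares

variable {n : ℕ} {K : Set (EuclideanSpace ℝ (Fin n))}

theorem inner_sub_lse_le_zero (hne : K.Nonempty) (hcl : IsClosed K) (hK : Convex ℝ K)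
    (y : EuclideanSpace ℝ (Fin n)) {ν : EuclideanSpace ℝ (Fin n)} (hν : ν ∈ K) :
    inner ℝ (y - lse K y) (ν - lse K y) ≤ 0 := by
  obtain ⟨h1, h2⟩ := lse_spec hne hcl y
  refine (norm_eq_iInf_iff_real_inner_le_zero hK h1).1 ?_ ν hν
  have : Nonempty K := hne.to_subtype
  refine le_antisymm (le_ciInf fun w => ?_)
    (ciInf_le ⟨0, by rintro _ ⟨w, rfl⟩; exact norm_nonneg _⟩ (⟨_, h1⟩ : K))
  exact le_of_sq_le_sq (h2 w w.2) (norm_nonneg _)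

theorem norm_lse_sub_lse_le (hne : K.Nonempty) (hcl : IsClosed K) (hK : Convex ℝ K)
    (y z : EuclideanSpace ℝ (Fin n)) : ‖lse K y - lse K z‖ ≤ ‖y - z‖ := by
  have h1 := inner_sub_lse_le_zero hne hcl hK y (lse_spec hne hcl z).1
  have h2 := inner_sub_lse_le_zero hne hcl hK z (lse_spec hne hcl y).1
  have h3 : inner ℝ (y - z) (lse K y - lse K z) = ‖lse K y - lse K z‖ ^ 2
      - inner ℝ (y - lse K y) (lse K z - lse K y)
      - inner ℝ (z - lse K z) (lse K y - lse K z) := by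
    rw [← real_inner_self_eq_norm_sq, ← neg_sub (lse K y) (lse K z), inner_neg_right,
      sub_neg_eq_add, ← inner_add_left, ← inner_sub_left]
    congr 1
    abel
  have h4 := real_inner_le_norm (y - z) (lse K y - lse K z)
  by_contra! h
  nlinarith [norm_nonneg (y - z), norm_nonneg (lse K y - lse K z)]

theorem lse_eq_self (hne : K.Nonempty) (hcl : IsClosed K) {μ : EuclideanSpace ℝ (Fin n)}
    (hμ : μ ∈ K) : lse K μ = μ := by
  have h := (lse_spec hne hcl μ).2 μ hμ
  rw [sub_self, norm_zero, zero_pow two_ne_zero] at h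
  have h2 : ‖μ - lse K μ‖ = 0 := by nlinarith [norm_nonneg (μ - lse K μ)]
  exact (sub_eq_zero.1 (norm_eq_zero.1 h2)).symm

/-- The loss `‖μ̂ - μ‖` of the least squares estimator as a function of the noise. -/
noncomputable def lseLoss (K : Set (EuclideanSpace ℝ (Fin n))) (σ : ℝ)
    (μ x : EuclideanSpace ℝ (Fin n)) : ℝ := ‖lse K (μ + σ • x) - μ‖

/-- Nonexpansiveness of the projection. It makes the loss concentrate at scale `σ` in every
dimension. -/
theorem lipschitzWith_lseLoss (hne : K.Nonempty) (hcl : IsClosed K) (hK : Convex ℝ K) {σ : ℝ}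
    (hσ : 0 < σ) (μ : EuclideanSpace ℝ (Fin n)) :
    LipschitzWith σ.toNNReal (lseLoss K σ μ) := by
  refine LipschitzWith.of_dist_le_mul fun x y => ?_
  rw [Real.dist_eq, Real.coe_toNNReal _ hσ.le, dist_eq_norm]
  refine (abs_norm_sub_norm_le _ _).trans ?_
  rw [sub_sub_sub_cancel_right]
  refine (norm_lse_sub_lse_le hne hcl hK _ _).trans_eq ?_
  rw [add_sub_add_left_eq_sub, ← smul_sub, norm_smul, Real.norm_of_nonneg hσ.le]

theorem lseLoss_le (hne : K.Nonempty) (hcl : IsClosed K) (hK : Convex ℝ K) {σ : ℝ}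
    (hσ : 0 < σ) {μ : EuclideanSpace ℝ (Fin n)} (hμ : μ ∈ K) (x : EuclideanSpace ℝ (Fin n)) :
    lseLoss K σ μ x ≤ σ * ‖x‖ := by
  have h := norm_lse_sub_lse_le hne hcl hK (μ + σ • x) μ
  rw [lse_eq_self hne hcl hμ, add_sub_cancel_left, norm_smul, Real.norm_of_nonneg hσ.le] at h
  exact h

theorem integrable_lseLoss_sq (hne : K.Nonempty) (hcl : IsClosed K) (hK : Convex ℝ K) {σ : ℝ}
    (hσ : 0 < σ) (μ : EuclideanSpace ℝ (Fin n)) :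
    Integrable (fun x => lseLoss K σ μ x ^ 2) (stdGaussian (EuclideanSpace ℝ (Fin n))) := by
  simpa using (lipschitzWith_lseLoss hne hcl hK hσ μ).integrable_sq_sub_stdGaussian 0

theorem lseRisk_eq (K : Set (EuclideanSpace ℝ (Fin n))) (σ : ℝ)
    (μ : EuclideanSpace ℝ (Fin n)) :
    lseRisk K σ μ = ∫ x, lseLoss K σ μ x ^ 2 ∂(stdGaussian (EuclideanSpace ℝ (Fin n))) := rfl

theorem lseRisk_nonneg (K : Set (EuclideanSpace ℝ (Fin n))) (σ : ℝ)
    (μ : EuclideanSpace ℝ (Fin n)) : 0 ≤ lseRisk K σ μ :=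
  integral_nonneg fun _ => by positivity

theorem bddAbove_lseRisk (hne : K.Nonempty) (hcl : IsClosed K) (hK : Convex ℝ K) {σ : ℝ}
    (hσ : 0 < σ) : BddAbove (lseRisk K σ '' K) := by
  refine ⟨σ ^ 2 * ∫ x, ‖x‖ ^ 2 ∂(stdGaussian (EuclideanSpace ℝ (Fin n))), ?_⟩
  rintro _ ⟨μ, hμ, rfl⟩
  rw [lseRisk_eq, ← integral_const_mul]
  refine integral_mono (integrable_lseLoss_sq hne hcl hK hσ μ)
    (integrable_norm_sq_stdGaussian.const_mul _) fun x => ?_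
  dsimp only
  rw [← mul_pow]
  exact pow_le_pow_left₀ (norm_nonneg _) (lseLoss_le hne hcl hK hσ hμ x) 2

theorem lseRisk_le_worstCaseRate_sq (hne : K.Nonempty) (hcl : IsClosed K) (hK : Convex ℝ K)
    {σ : ℝ} (hσ : 0 < σ) {μ : EuclideanSpace ℝ (Fin n)} (hμ : μ ∈ K) :
    lseRisk K σ μ ≤ worstCaseRate K σ ^ 2 := by
  have h := le_csSup (bddAbove_lseRisk hne hcl hK hσ) (Set.mem_image_of_mem (lseRisk K σ) hμ)
  rwa [worstCaseRate, Real.sq_sqrt ((lseRisk_nonneg K σ μ).trans h)]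

theorem worstCaseRate_le (hne : K.Nonempty) {σ a : ℝ} (ha : 0 ≤ a)
    (h : ∀ μ ∈ K, Real.sqrt (lseRisk K σ μ) ≤ a) : worstCaseRate K σ ≤ a := by
  rw [worstCaseRate, Real.sqrt_le_left ha]
  refine csSup_le (hne.image _) ?_
  rintro _ ⟨μ, hμ, rfl⟩
  exact (Real.sqrt_le_left ha).1 (h μ hμ)

/-- The support function of the localized set `B(μ, r) ∩ K`, centred at `μ`. -/
noncomputable def localSup (K : Set (EuclideanSpace ℝ (Fin n))) (μ : EuclideanSpace ℝ (Fin n))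
    (r : ℝ) (x : EuclideanSpace ℝ (Fin n)) : ℝ :=
  sSup ((fun t => inner ℝ x (t - μ)) '' (Metric.closedBall μ r ∩ K))

theorem inner_sub_le_of_mem_closedBall {μ t : EuclideanSpace ℝ (Fin n)} {r : ℝ}
    (ht : t ∈ Metric.closedBall μ r) (x : EuclideanSpace ℝ (Fin n)) :
    inner ℝ x (t - μ) ≤ r * ‖x‖ := by
  rw [mem_closedBall_iff_norm] at ht
  have := real_inner_le_norm x (t - μ)
  nlinarith [norm_nonneg x]

theorem le_localSup {μ t : EuclideanSpace ℝ (Fin n)} {r : ℝ} (ht : t ∈ Metric.closedBall μ r)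
    (htK : t ∈ K) (x : EuclideanSpace ℝ (Fin n)) :
    inner ℝ x (t - μ) ≤ localSup K μ r x := by
  refine le_csSup ⟨r * ‖x‖, ?_⟩ ⟨t, ⟨ht, htK⟩, rfl⟩
  rintro _ ⟨s, hs, rfl⟩
  exact inner_sub_le_of_mem_closedBall hs.1 x

theorem localSup_le {μ : EuclideanSpace ℝ (Fin n)} (hμ : μ ∈ K) {r : ℝ} (hr : 0 ≤ r)
    {x : EuclideanSpace ℝ (Fin n)} {a : ℝ}
    (h : ∀ t ∈ Metric.closedBall μ r, t ∈ K → inner ℝ x (t - μ) ≤ a) :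
    localSup K μ r x ≤ a := by
  refine csSup_le ⟨_, μ, ⟨Metric.mem_closedBall_self hr, hμ⟩, rfl⟩ ?_
  rintro _ ⟨t, ht, rfl⟩
  exact h t ht.1 ht.2

theorem localSup_nonneg {μ : EuclideanSpace ℝ (Fin n)} (hμ : μ ∈ K) {r : ℝ} (hr : 0 ≤ r)
    (x : EuclideanSpace ℝ (Fin n)) : 0 ≤ localSup K μ r x := by
  simpa using le_localSup (Metric.mem_closedBall_self hr) hμ x

theorem localSup_le_mul_norm {μ : EuclideanSpace ℝ (Fin n)} (hμ : μ ∈ K) {r : ℝ} (hr : 0 ≤ r)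
    (x : EuclideanSpace ℝ (Fin n)) : localSup K μ r x ≤ r * ‖x‖ :=
  localSup_le hμ hr fun _ ht _ => inner_sub_le_of_mem_closedBall ht x

theorem localSup_mono {μ : EuclideanSpace ℝ (Fin n)} (hμ : μ ∈ K) {r s : ℝ} (hr : 0 ≤ r)
    (hrs : r ≤ s) (x : EuclideanSpace ℝ (Fin n)) : localSup K μ r x ≤ localSup K μ s x :=
  localSup_le hμ hr fun _ ht htK => le_localSup (Metric.closedBall_subset_closedBall hrs ht) htK x

theorem lipschitzWith_localSup {μ : EuclideanSpace ℝ (Fin n)} (hμ : μ ∈ K) {r : ℝ}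
    (hr : 0 ≤ r) : LipschitzWith r.toNNReal (localSup K μ r) := by
  refine LipschitzWith.of_le_add_mul _ fun x y => ?_
  rw [Real.coe_toNNReal _ hr, dist_eq_norm]
  refine localSup_le hμ hr fun t ht htK => ?_
  have h1 := le_localSup ht htK y
  have h2 := inner_sub_le_of_mem_closedBall ht (x - y)
  rw [inner_sub_left] at h2
  linarith

theorem integrable_localSup {μ : EuclideanSpace ℝ (Fin n)} (hμ : μ ∈ K) {r : ℝ}
    (hr : 0 ≤ r) : Integrable (localSup K μ r) (stdGaussian (EuclideanSpace ℝ (Fin n))) :=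
  (lipschitzWith_localSup hμ hr).integrable_stdGaussian

theorem integral_inner_stdGaussian (ν : EuclideanSpace ℝ (Fin n)) :
    ∫ x, inner ℝ x ν ∂(stdGaussian (EuclideanSpace ℝ (Fin n))) = 0 := by
  have h := integral_strongDual_stdGaussian (innerSL ℝ ν)
  simpa [real_inner_comm] using h

theorem integrable_inner_stdGaussian (ν : EuclideanSpace ℝ (Fin n)) :
    Integrable (fun x => inner ℝ x ν) (stdGaussian (EuclideanSpace ℝ (Fin n))) := by
  refine (integrable_norm_stdGaussian.mul_const ‖ν‖).mono' (by fun_prop)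
    (.of_forall fun x => ?_)
  exact norm_inner_le_norm x ν

/-- Centring at `μ` subtracts `⟨x, μ⟩`, which has mean zero; it leaves a nonnegative function with
Lipschitz constant `r`. -/
theorem localWidth_eq {μ : EuclideanSpace ℝ (Fin n)} (hμ : μ ∈ K) {r : ℝ} (hr : 0 ≤ r) :
    localWidth K μ r = ∫ x, localSup K μ r x ∂(stdGaussian (EuclideanSpace ℝ (Fin n))) := by
  have h : ∀ x : EuclideanSpace ℝ (Fin n),
      sSup ((fun t => inner ℝ x t) '' (Metric.closedBall μ r ∩ K)) =
        localSup K μ r x + inner ℝ x μ := by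
    intro x
    have hne : ((fun t => inner ℝ x t) '' (Metric.closedBall μ r ∩ K)).Nonempty :=
      ⟨_, μ, ⟨Metric.mem_closedBall_self hr, hμ⟩, rfl⟩
    have hb : ∀ t ∈ Metric.closedBall μ r ∩ K, inner ℝ x t ≤ localSup K μ r x + inner ℝ x μ := by
      intro t ht
      have := le_localSup ht.1 ht.2 x
      rw [inner_sub_right] at this
      linarith
    refine le_antisymm (csSup_le hne (by rintro _ ⟨t, ht, rfl⟩; exact hb t ht)) ?_
    rw [← le_sub_iff_add_le]
    refine localSup_le hμ hr fun t ht htK => ?_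
    rw [inner_sub_right]
    have : inner ℝ x t ≤ sSup ((fun t => inner ℝ x t) '' (Metric.closedBall μ r ∩ K)) :=
      le_csSup ⟨_, by rintro _ ⟨s, hs, rfl⟩; exact hb s hs⟩ ⟨t, ⟨ht, htK⟩, rfl⟩
    linarith
  rw [localWidth, gaussianWidth]
  simp_rw [h]
  rw [integral_add (integrable_localSup hμ hr) (integrable_inner_stdGaussian μ),
    integral_inner_stdGaussian, add_zero]

theorem localWidth_nonneg {μ : EuclideanSpace ℝ (Fin n)} (hμ : μ ∈ K) {r : ℝ} (hr : 0 ≤ r) :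
    0 ≤ localWidth K μ r := by
  rw [localWidth_eq hμ hr]
  exact integral_nonneg fun x => localSup_nonneg hμ hr x

theorem localWidth_le {μ : EuclideanSpace ℝ (Fin n)} (hμ : μ ∈ K) {r : ℝ} (hr : 0 ≤ r) :
    localWidth K μ r ≤ r * ∫ x, ‖x‖ ∂(stdGaussian (EuclideanSpace ℝ (Fin n))) := by
  rw [localWidth_eq hμ hr, ← integral_const_mul]
  exact integral_mono (integrable_localSup hμ hr) (integrable_norm_stdGaussian.const_mul _)
    fun x => localSup_le_mul_norm hμ hr x

/-- Local widths over nested balls with different centres. -/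
theorem localWidth_le_localWidth {μ ν : EuclideanSpace ℝ (Fin n)} (hμ : μ ∈ K) (hν : ν ∈ K)
    {r s : ℝ} (hr : 0 ≤ r) (hrs : r + ‖ν - μ‖ ≤ s) : localWidth K ν r ≤ localWidth K μ s := by
  have hs : 0 ≤ s := by linarith [norm_nonneg (ν - μ)]
  have h : ∀ x, localSup K ν r x ≤ localSup K μ s x - inner ℝ x (ν - μ) := by
    intro x
    refine localSup_le hν hr fun t ht htK => ?_
    have ht' : t ∈ Metric.closedBall μ s := by
      rw [mem_closedBall_iff_norm] at ht ⊢
      have := norm_sub_le_norm_sub_add_norm_sub t ν μ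
      linarith
    have := le_localSup ht' htK x
    rw [inner_sub_right] at this ⊢
    rw [inner_sub_right]
    linarith
  have h2 := integral_mono (integrable_localSup hν hr)
    ((integrable_localSup hμ hs).sub (integrable_inner_stdGaussian (ν - μ))) h
  simp only [Pi.sub_apply] at h2
  rwa [integral_sub (integrable_localSup hμ hs) (integrable_inner_stdGaussian _),
    integral_inner_stdGaussian, sub_zero, ← localWidth_eq hμ hs, ← localWidth_eq hν hr] at h2

/-- The obtuse angle inequality at `p = μ̂`, expanded around `μ` and followed by Cauchy–Schwarz.
Read as `⟨x, t - μ⟩ ≤ ⟨x, p - μ⟩ + (Z/σ)(‖t - μ‖ - Z)`, it is the supergradient property of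
`localSup` at the radius `Z`. -/
theorem mul_inner_sub_lse_le (hne : K.Nonempty) (hcl : IsClosed K) (hK : Convex ℝ K) (σ : ℝ)
    (μ x : EuclideanSpace ℝ (Fin n)) {t : EuclideanSpace ℝ (Fin n)} (ht : t ∈ K) :
    σ * inner ℝ x (t - lse K (μ + σ • x)) ≤
      lseLoss K σ μ x * ‖t - μ‖ - lseLoss K σ μ x ^ 2 := by
  have h := inner_sub_lse_le_zero hne hcl hK (μ + σ • x) ht
  set p := lse K (μ + σ • x) with hp
  have h1 : inner ℝ (μ + σ • x - p) (t - p) =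
      σ * inner ℝ x (t - p) - inner ℝ (p - μ) (t - μ) + ‖p - μ‖ ^ 2 := by
    rw [← real_inner_self_eq_norm_sq, ← real_inner_smul_left, sub_add, ← inner_sub_right,
      sub_sub_sub_cancel_right, ← inner_sub_left]
    congr 1
    abel
  have h2 := real_inner_le_norm (p - μ) (t - μ)
  simp only [lseLoss, ← hp]
  linarith

/-- By concavity, `localSup` grows below the loss with slope at least `lseLoss / σ`. -/
theorem localSup_add_le (hcl : IsClosed K) (hK : Convex ℝ K) {σ : ℝ} (hσ : 0 < σ)
    {μ : EuclideanSpace ℝ (Fin n)} (hμ : μ ∈ K) {r s : ℝ} (hr : 0 ≤ r) (hrs : r ≤ s)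
    (x : EuclideanSpace ℝ (Fin n)) :
    localSup K μ r x + lseLoss K σ μ x / σ * (min (lseLoss K σ μ x) s - r) ≤
      localSup K μ s x := by
  have hne : K.Nonempty := ⟨μ, hμ⟩
  have hZ0 : 0 ≤ lseLoss K σ μ x := norm_nonneg _
  rcases le_or_gt (lseLoss K σ μ x) r with h | h
  · have h1 := localSup_mono hμ hr hrs x
    have h2 : min (lseLoss K σ μ x) s - r ≤ 0 := by linarith [min_le_left (lseLoss K σ μ x) s]
    have h3 := mul_nonpos_of_nonneg_of_nonpos (div_nonneg hZ0 hσ.le) h2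
    linarith
  rw [← le_sub_iff_add_le]
  refine localSup_le hμ hr fun t ht htK => ?_
  have key := mul_inner_sub_lse_le hne hcl hK σ μ x htK
  have hpK := (lse_spec hne hcl (μ + σ • x)).1
  have hZ : lseLoss K σ μ x = ‖lse K (μ + σ • x) - μ‖ := rfl
  set Z := lseLoss K σ μ x
  set p := lse K (μ + σ • x)
  rw [mem_closedBall_iff_norm] at ht
  set m := min Z s with hm
  have hmr : r ≤ m := le_min h.le hrs
  have hmZ : m ≤ Z := min_le_left _ _
  -- Moving from `t` towards the estimator by this fraction reaches distance at most `m = min Z s`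
  -- from `μ`.
  set a := (m - r) / (Z - r) with ha
  have hZr : 0 < Z - r := sub_pos.2 h
  have ha0 : 0 ≤ a := div_nonneg (by linarith) hZr.le
  have ha1 : a ≤ 1 := (div_le_one hZr).2 (by linarith)
  have haZ : a * (Z - r) = m - r := div_mul_cancel₀ _ hZr.ne'
  have hq : (1 - a) • t + a • p ∈ K := hK htK hpK (by linarith) ha0 (by ring)
  have hqb : (1 - a) • t + a • p ∈ Metric.closedBall μ s := by
    rw [mem_closedBall_iff_norm]
    have e : (1 - a) • t + a • p - μ = (1 - a) • (t - μ) + a • (p - μ) := by module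
    rw [e]
    calc _ ≤ ‖(1 - a) • (t - μ)‖ + ‖a • (p - μ)‖ := norm_add_le _ _
      _ = (1 - a) * ‖t - μ‖ + a * Z := by
        rw [norm_smul, norm_smul, Real.norm_of_nonneg ha0, Real.norm_of_nonneg (by linarith), hZ]
      _ ≤ (1 - a) * r + a * Z := by gcongr
      _ = m := by linarith
      _ ≤ s := min_le_right _ _
  have h1 := le_localSup hqb hq x
  have e : inner ℝ x ((1 - a) • t + a • p - μ) = inner ℝ x (t - μ) - a * inner ℝ x (t - p) := by
    rw [← real_inner_smul_right, ← inner_sub_right]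
    congr 1
    module
  rw [e] at h1
  have h2 : σ * inner ℝ x (t - p) ≤ -(Z * (Z - r)) := by nlinarith
  have h3 : inner ℝ x (t - p) ≤ -(Z * (Z - r)) / σ := by
    rw [le_div_iff₀ hσ]; linarith
  have h4 : a * inner ℝ x (t - p) ≤ a * (-(Z * (Z - r)) / σ) := by gcongr
  have h5 : a * (-(Z * (Z - r)) / σ) = -(Z / σ * (m - r)) := by rw [← haZ]; ring
  linarith

/-- By concavity, `localSup` grows above the loss with slope at most `lseLoss / σ`. -/
theorem localSup_le_add (hcl : IsClosed K) (hK : Convex ℝ K) {σ : ℝ} (hσ : 0 < σ)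
    {μ : EuclideanSpace ℝ (Fin n)} (hμ : μ ∈ K) {r s : ℝ} (hr : 0 ≤ r) (hrs : r ≤ s)
    (x : EuclideanSpace ℝ (Fin n)) (hZr : lseLoss K σ μ x < r) :
    localSup K μ s x ≤ localSup K μ r x + lseLoss K σ μ x / σ * (s - r) := by
  have hne : K.Nonempty := ⟨μ, hμ⟩
  have hZ0 : 0 ≤ lseLoss K σ μ x := norm_nonneg _
  refine localSup_le hμ (hr.trans hrs) fun t ht htK => ?_
  have key := mul_inner_sub_lse_le hne hcl hK σ μ x htK
  have hpK := (lse_spec hne hcl (μ + σ • x)).1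
  have hZ : lseLoss K σ μ x = ‖lse K (μ + σ • x) - μ‖ := rfl
  set Z := lseLoss K σ μ x
  set p := lse K (μ + σ • x)
  rw [mem_closedBall_iff_norm] at ht
  have hsZ : 0 < s - Z := by linarith
  -- Here the estimator is moved towards `t` until the guaranteed distance from `μ` is `r`.
  set a := (r - Z) / (s - Z) with ha
  have ha0 : 0 ≤ a := div_nonneg (by linarith) hsZ.le
  have ha1 : a ≤ 1 := (div_le_one hsZ).2 (by linarith)
  have haZ : a * (s - Z) = r - Z := div_mul_cancel₀ _ hsZ.ne'
  have hq : (1 - a) • p + a • t ∈ K := hK hpK htK (by linarith) ha0 (by ring)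
  have hqb : (1 - a) • p + a • t ∈ Metric.closedBall μ r := by
    rw [mem_closedBall_iff_norm]
    have e : (1 - a) • p + a • t - μ = (1 - a) • (p - μ) + a • (t - μ) := by module
    rw [e]
    calc _ ≤ ‖(1 - a) • (p - μ)‖ + ‖a • (t - μ)‖ := norm_add_le _ _
      _ = (1 - a) * Z + a * ‖t - μ‖ := by
        rw [norm_smul, norm_smul, Real.norm_of_nonneg ha0, Real.norm_of_nonneg (by linarith), hZ]
      _ ≤ (1 - a) * Z + a * s := by gcongr
      _ = r := by linarith
  have h1 := le_localSup hqb hq x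
  have e : inner ℝ x ((1 - a) • p + a • t - μ) =
      inner ℝ x (t - μ) - (1 - a) * inner ℝ x (t - p) := by
    rw [← real_inner_smul_right, ← inner_sub_right]
    congr 1
    module
  rw [e] at h1
  have h2 : σ * inner ℝ x (t - p) ≤ Z * (s - Z) := by nlinarith
  have h3 : inner ℝ x (t - p) ≤ Z * (s - Z) / σ := by
    rw [le_div_iff₀ hσ]; linarith
  have h4 : (1 - a) * inner ℝ x (t - p) ≤ (1 - a) * (Z * (s - Z) / σ) := by
    have : 0 ≤ 1 - a := by linarith
    gcongr
  have h5 : (1 - a) * (Z * (s - Z) / σ) = Z / σ * (s - r) := by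
    have : (1 - a) * (s - Z) = s - r := by linarith
    rw [← this]; ring
  linarith

end LeastSquares

/-! ### Finiteness of local packings, covers and attained packings. -/

section LocalPacking

theorem isSeparated_toNNReal_iff {X : Type*} [PseudoMetricSpace X] {δ : ℝ} (hδ : 0 ≤ δ)
    {C : Set X} :
    Metric.IsSeparated (δ.toNNReal : ℝ≥0∞) C ↔ C.Pairwise fun x y => δ < dist x y := by
  have h : ∀ x y : X, (δ.toNNReal : ℝ≥0∞) < edist x y ↔ δ < dist x y := by
    intro x y
    rw [edist_dist]
    exact ENNReal.ofReal_lt_ofReal_iff_of_nonneg hδ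
  exact ⟨fun hC x hx y hy hxy => (h x y).1 (hC hx hy hxy),
    fun hC x hx y hy hxy => (h x y).2 (hC hx hy hxy)⟩

variable {n : ℕ} {K : Set (EuclideanSpace ℝ (Fin n))}

theorem packingNumber_closedBall_ne_top (δ : ℝ) (hδ : 0 < δ) :
    Metric.packingNumber δ.toNNReal
      (Metric.closedBall (0 : EuclideanSpace ℝ (Fin n)) 1) ≠ ⊤ := by
  have htb : TotallyBounded (Metric.closedBall (0 : EuclideanSpace ℝ (Fin n)) 1) :=
    (isCompact_closedBall _ _).totallyBounded
  obtain ⟨t, ht, hcov⟩ := Metric.totallyBounded_iff.1 htb (δ / 2) (by positivity)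
  have hc : Metric.IsCover (δ / 2).toNNReal
      (Metric.closedBall (0 : EuclideanSpace ℝ (Fin n)) 1) t := by
    intro x hx
    obtain ⟨y, hy, hxy⟩ := Set.mem_iUnion₂.1 (hcov hx)
    refine ⟨y, hy, ?_⟩
    change edist x y ≤ _
    rw [edist_dist]
    exact ENNReal.ofReal_le_ofReal (Metric.mem_ball.1 hxy).le
  have h := (Metric.packingNumber_two_mul_le_externalCoveringNumber (δ / 2).toNNReal
    (Metric.closedBall (0 : EuclideanSpace ℝ (Fin n)) 1)).trans hc.externalCoveringNumber_le_encard
  have e : 2 * (δ / 2).toNNReal = δ.toNNReal := by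
    ext
    rw [NNReal.coe_mul, Real.coe_toNNReal _ (by positivity), Real.coe_toNNReal _ hδ.le]
    norm_num
    ring
  rw [e] at h
  exact ne_top_of_le_ne_top (Set.encard_ne_top_iff.2 ht) h

/-- The local packing numbers are bounded by the packing number of the unit ball. -/
theorem localPacking_le {c ε : ℝ} (hc : 0 < c) (hε : 0 < ε) :
    localPacking c K ε ≤ Metric.packingNumber (1 / c).toNNReal
      (Metric.closedBall (0 : EuclideanSpace ℝ (Fin n)) 1) := by
  refine iSup₂_le fun θ _ => iSup₂_le fun C hC => iSup_le fun hsep => ?_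
  rw [isSeparated_toNNReal_iff (by positivity)] at hsep
  have hdist : ∀ x y : EuclideanSpace ℝ (Fin n),
      dist (ε⁻¹ • (x - θ)) (ε⁻¹ • (y - θ)) = ε⁻¹ * dist x y := by
    intro x y
    rw [dist_smul₀, dist_sub_right, Real.norm_of_nonneg (by positivity)]
  have hinj : Function.Injective fun x : EuclideanSpace ℝ (Fin n) => ε⁻¹ • (x - θ) := by
    intro x y hxy
    have h := hdist x y
    rw [show ε⁻¹ • (x - θ) = ε⁻¹ • (y - θ) from hxy, dist_self] at h
    exact dist_eq_zero.1 ((mul_eq_zero.1 h.symm).resolve_left (by positivity))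
  rw [← hinj.encard_image]
  refine Metric.IsSeparated.encard_le_packingNumber ?_ ?_
  · rintro _ ⟨x, hx, rfl⟩
    have h := (hC hx).1
    rw [mem_closedBall_iff_norm] at h
    rw [mem_closedBall_zero_iff, norm_smul, Real.norm_of_nonneg (by positivity),
      inv_mul_le_iff₀ hε]
    linarith
  · rw [isSeparated_toNNReal_iff (by positivity)]
    rintro _ ⟨x, hx, rfl⟩ _ ⟨y, hy, rfl⟩ hxy
    rw [hdist]
    have h := hsep hx hy (fun h => hxy (by rw [h]))
    calc 1 / c = ε⁻¹ * (ε / c) := by field_simp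
      _ < ε⁻¹ * dist x y := by gcongr

theorem localPacking_ne_top {c ε : ℝ} (hc : 0 < c) (hε : 0 < ε) : localPacking c K ε ≠ ⊤ :=
  ne_top_of_le_ne_top (packingNumber_closedBall_ne_top (1 / c) (by positivity))
    (localPacking_le hc hε)

theorem localEntropy_le {c ε : ℝ} (hc : 0 < c) (hε : 0 < ε) :
    localEntropy c K ε ≤ Real.log (1 + ((Metric.packingNumber (1 / c).toNNReal
      (Metric.closedBall (0 : EuclideanSpace ℝ (Fin n)) 1)).toNat : ℝ)) := by
  have h : (localPacking c K ε).toNat ≤ _ := ENat.toNat_le_toNat (localPacking_le (K := K) hc hε)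
    (packingNumber_closedBall_ne_top (1 / c) (by positivity))
  -- A zero count has logarithm `0` by convention; the summand `1` on the right keeps that side
  -- nonnegative.
  rcases Nat.eq_zero_or_pos (localPacking c K ε).toNat with h0 | h0
  · rw [localEntropy, h0, Nat.cast_zero, Real.log_zero]
    exact Real.log_nonneg (by simp)
  · refine Real.log_le_log (by exact_mod_cast h0) ?_
    have : ((localPacking c K ε).toNat : ℝ) ≤ _ := Nat.cast_le.2 h
    linarith

/-- A maximal packing is a finite cover. -/
theorem exists_finset_cover {c ε : ℝ} (hc : 0 < c) (hε : 0 < ε) {θ : EuclideanSpace ℝ (Fin n)}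
    (hθ : θ ∈ K) :
    ∃ S : Finset (EuclideanSpace ℝ (Fin n)), S.Nonempty ∧
      (∀ p ∈ S, p ∈ Metric.closedBall θ ε ∩ K) ∧
      (∀ t ∈ Metric.closedBall θ ε ∩ K, ∃ p ∈ S, t ∈ Metric.closedBall p (ε / c)) ∧
      Real.log S.card ≤ localEntropy c K ε := by
  have hle : Metric.packingNumber (ε / c).toNNReal (Metric.closedBall θ ε ∩ K) ≤
      localPacking c K ε :=
    le_iSup₂ (f := fun θ (_ : θ ∈ K) =>
      Metric.packingNumber (ε / c).toNNReal (Metric.closedBall θ ε ∩ K)) θ hθ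
  have htop := ne_top_of_le_ne_top (localPacking_ne_top (K := K) hc hε) hle
  have hcard := Metric.encard_maximalSeparatedSet htop
  have hfin : (Metric.maximalSeparatedSet (ε / c).toNNReal
      (Metric.closedBall θ ε ∩ K)).Finite := by
    rw [← Set.encard_ne_top_iff, hcard]; exact htop
  have hcov : ∀ t ∈ Metric.closedBall θ ε ∩ K, ∃ p ∈ hfin.toFinset,
      t ∈ Metric.closedBall p (ε / c) := by
    intro t ht
    obtain ⟨p, hp, htp⟩ := Metric.isCover_maximalSeparatedSet htop ht
    refine ⟨p, hfin.mem_toFinset.2 hp, ?_⟩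
    change edist t p ≤ _ at htp
    rw [edist_dist] at htp
    exact (ENNReal.ofReal_le_ofReal_iff (by positivity)).1 htp
  have hne : hfin.toFinset.Nonempty := by
    obtain ⟨p, hp, -⟩ := hcov θ ⟨Metric.mem_closedBall_self hε.le, hθ⟩
    exact ⟨p, hp⟩
  refine ⟨hfin.toFinset, hne, fun p hp =>
    Metric.maximalSeparatedSet_subset (hfin.mem_toFinset.1 hp), hcov, ?_⟩
  refine Real.log_le_log (by exact_mod_cast hne.card_pos) ?_
  rw [Nat.cast_le]
  rw [hfin.encard_eq_coe_toFinset_card] at hcard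
  rw [← hcard] at hle
  exact (ENat.toNat_le_toNat hle (localPacking_ne_top hc hε))

/-- The local packing number is attained. -/
theorem exists_finset_packing {c ε : ℝ} (hc : 0 < c) (hε : 0 < ε)
    (hpos : 0 < (localPacking c K ε).toNat) :
    ∃ θ ∈ K, ∃ S : Finset (EuclideanSpace ℝ (Fin n)), S.card = (localPacking c K ε).toNat ∧
      (∀ p ∈ S, p ∈ Metric.closedBall θ ε ∩ K) ∧
      (S : Set (EuclideanSpace ℝ (Fin n))).Pairwise fun x y => ε / c < dist x y := by
  set M := (localPacking c K ε).toNat with hM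
  have hMe : (M : ℕ∞) = localPacking c K ε := ENat.natCast_toNat (localPacking_ne_top hc hε)
  -- A packing with more than `M - 1` points has at least `M`, so the supremum is reached by a
  -- subset with exactly `M` points.
  have hlt : ((M - 1 : ℕ) : ℕ∞) < localPacking c K ε := by
    rw [← hMe, Nat.cast_lt]; omega
  simp only [localPacking, Metric.packingNumber, lt_iSup_iff] at hlt
  obtain ⟨θ, hθ, C, hC, hsep, hcard⟩ := hlt
  rw [isSeparated_toNNReal_iff (by positivity)] at hsep
  have hMC : (M : ℕ∞) ≤ C.encard := by
    have := Order.add_one_le_of_lt hcard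
    have e : ((M - 1 : ℕ) : ℕ∞) + 1 = M := by
      have : M - 1 + 1 = M := by omega
      exact_mod_cast this
    rwa [e] at this
  obtain ⟨D, hDC, hD⟩ := Set.exists_subset_encard_eq hMC
  have hfin : D.Finite := by
    rw [← Set.encard_ne_top_iff, hD]; exact ENat.natCast_ne_top M
  refine ⟨θ, hθ, hfin.toFinset, ?_, fun p hp => hC (hDC (hfin.mem_toFinset.1 hp)), ?_⟩
  · rw [hfin.encard_eq_coe_toFinset_card] at hD
    exact_mod_cast hD
  · rw [hfin.coe_toFinset]
    exact hsep.mono hDC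

end LocalPacking

/-! ### The set of radii that defines the critical radius. -/

section CriticalRadius

variable {n : ℕ} {K : Set (EuclideanSpace ℝ (Fin n))}

theorem mem_upperBounds_widthGap {c : ℝ} (hc : 0 < c) {ε : ℝ} (hε : 0 ≤ ε) :
    ε / c * ∫ x, ‖x‖ ∂(stdGaussian (EuclideanSpace ℝ (Fin n))) ∈
      upperBounds {r : ℝ | ∃ ν₁ ∈ K, ∃ ν₂ ∈ K, ‖ν₁ - ν₂‖ ≤ 2 * ε ∧
        r = localWidth K ν₁ (ε / c) - localWidth K ν₂ (ε / c)} := by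
  rintro _ ⟨ν₁, h₁, ν₂, h₂, -, rfl⟩
  have e1 := localWidth_le h₁ (div_nonneg hε hc.le)
  have e2 := localWidth_nonneg h₂ (div_nonneg hε hc.le)
  linarith

theorem le_maxWidthGap {c : ℝ} (hc : 0 < c) {ε : ℝ} (hε : 0 ≤ ε)
    {ν₁ ν₂ : EuclideanSpace ℝ (Fin n)} (h₁ : ν₁ ∈ K) (h₂ : ν₂ ∈ K) (h : ‖ν₁ - ν₂‖ ≤ 2 * ε) :
    localWidth K ν₁ (ε / c) - localWidth K ν₂ (ε / c) ≤ maxWidthGap c K ε :=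
  le_csSup ⟨_, mem_upperBounds_widthGap hc hε⟩ ⟨ν₁, h₁, ν₂, h₂, h, rfl⟩

theorem nonempty_widthGap (hne : K.Nonempty) (c : ℝ) {ε : ℝ} (hε : 0 ≤ ε) :
    {r : ℝ | ∃ ν₁ ∈ K, ∃ ν₂ ∈ K, ‖ν₁ - ν₂‖ ≤ 2 * ε ∧
        r = localWidth K ν₁ (ε / c) - localWidth K ν₂ (ε / c)}.Nonempty := by
  obtain ⟨ν, hν⟩ := hne
  exact ⟨_, ν, hν, ν, hν, by simpa using hε, rfl⟩

theorem maxWidthGap_le (hne : K.Nonempty) {c : ℝ} (hc : 0 < c) {ε : ℝ} (hε : 0 ≤ ε) :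
    maxWidthGap c K ε ≤ ε / c * ∫ x, ‖x‖ ∂(stdGaussian (EuclideanSpace ℝ (Fin n))) :=
  csSup_le (nonempty_widthGap hne c hε) (mem_upperBounds_widthGap hc hε)

theorem widthConst_eq (c : ℝ) : widthConst c = 8 + 8 / c := by
  unfold widthConst; ring

/-- Gap and entropy terms grow at most linearly in `ε`, the penalty quadratically. The bound depends
on `n`, but only finiteness matters: an unbounded set would get supremum `0`. -/
theorem bddAbove_epsBar (hne : K.Nonempty) {c L : ℝ} (hc : 0 < c) (hL : 0 < L) {σ : ℝ}
    (hσ : 0 < σ) :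
    BddAbove {ε : ℝ | 0 ≤ ε ∧ 0 ≤ maxWidthGap c K ε - widthConst c * ε ^ 2 / (2 * σ)
      + L / c * ε * Real.sqrt (localEntropy c K ε)} := by
  set W := ∫ x, ‖x‖ ∂(stdGaussian (EuclideanSpace ℝ (Fin n)))
  set N := Real.log (1 + ((Metric.packingNumber (1 / c).toNNReal
      (Metric.closedBall (0 : EuclideanSpace ℝ (Fin n)) 1)).toNat : ℝ))
  have hW : 0 ≤ W := integral_nonneg fun x => norm_nonneg x
  have hC : 0 < widthConst c := by rw [widthConst_eq]; positivity
  refine ⟨2 * σ / widthConst c * (W / c + L / c * Real.sqrt N), ?_⟩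
  rintro ε ⟨h0, h⟩
  rcases h0.eq_or_lt with h0 | h0
  · rw [← h0]; positivity
  have h1 := maxWidthGap_le hne hc h0.le
  have h2 : L / c * ε * Real.sqrt (localEntropy c K ε) ≤ L / c * ε * Real.sqrt N := by
    gcongr
    exact localEntropy_le hc h0
  have h3 : widthConst c * ε ^ 2 / (2 * σ) ≤ ε * (W / c + L / c * Real.sqrt N) := by
    have : ε / c * W + L / c * ε * Real.sqrt N = ε * (W / c + L / c * Real.sqrt N) := by ring
    linarith
  have h4 : ε * (widthConst c * ε / (2 * σ)) ≤ ε * (W / c + L / c * Real.sqrt N) := by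
    refine le_trans (le_of_eq ?_) h3
    ring
  have h5 := le_of_mul_le_mul_left h4 h0
  rw [div_le_iff₀ (by positivity)] at h5
  rw [div_mul_eq_mul_div, le_div_iff₀ hC]
  linarith

theorem le_epsBar (hne : K.Nonempty) {c L : ℝ} (hc : 0 < c) (hL : 0 < L) {σ : ℝ}
    (hσ : 0 < σ) {ε : ℝ} (hε : 0 ≤ ε)
    (h : widthConst c * ε ^ 2 / (2 * σ) ≤ maxWidthGap c K ε
      + L / c * ε * Real.sqrt (localEntropy c K ε)) : ε ≤ epsBar c L K σ :=
  le_csSup (bddAbove_epsBar hne hc hL hσ) ⟨hε, by linarith⟩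

theorem nonempty_epsBar (hne : K.Nonempty) (c L σ : ℝ) :
    {ε : ℝ | 0 ≤ ε ∧ 0 ≤ maxWidthGap c K ε - widthConst c * ε ^ 2 / (2 * σ)
      + L / c * ε * Real.sqrt (localEntropy c K ε)}.Nonempty := by
  obtain ⟨ν, hν⟩ := hne
  refine ⟨0, le_rfl, ?_⟩
  have h : maxWidthGap c K 0 = 0 := by
    have : {r : ℝ | ∃ ν₁ ∈ K, ∃ ν₂ ∈ K, ‖ν₁ - ν₂‖ ≤ 2 * (0 : ℝ) ∧
        r = localWidth K ν₁ (0 / c) - localWidth K ν₂ (0 / c)} = {0} := by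
      ext r
      constructor
      · rintro ⟨ν₁, -, ν₂, -, h, rfl⟩
        have : ν₁ = ν₂ := by
          rw [mul_zero] at h
          exact sub_eq_zero.1 (norm_le_zero_iff.1 h)
        rw [this, sub_self]; rfl
      · rintro rfl
        exact ⟨ν, hν, ν, hν, by simp, by simp⟩
    rw [maxWidthGap, this, csSup_singleton]
  simp [h]

theorem epsBar_mono (hne : K.Nonempty) {c L : ℝ} (hc : 0 < c) (hL : 0 < L) {σ σ' : ℝ}
    (hσ : 0 < σ) (hσσ' : σ ≤ σ') : epsBar c L K σ ≤ epsBar c L K σ' := by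
  refine csSup_le_csSup (bddAbove_epsBar hne hc hL (hσ.trans_le hσσ'))
    (nonempty_epsBar hne c L σ) ?_
  rintro ε ⟨h0, h⟩
  refine ⟨h0, h.trans ?_⟩
  have hC : 0 < widthConst c := by rw [widthConst_eq]; positivity
  have : widthConst c * ε ^ 2 / (2 * σ') ≤ widthConst c * ε ^ 2 / (2 * σ) := by gcongr
  linarith

end CriticalRadius

/-! ### The risk is bounded by the critical radius. -/

section UpperBound

variable {n : ℕ} {K : Set (EuclideanSpace ℝ (Fin n))}

/-- Covering `B(μ, ε) ∩ K` by balls of radius `ε / c` bounds the growth of the local width. -/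
theorem localWidth_sub_le {c : ℝ} (hc : 0 < c) {ε : ℝ} (hε : 0 < ε)
    {μ : EuclideanSpace ℝ (Fin n)} (hμ : μ ∈ K) :
    localWidth K μ ε - localWidth K μ (ε / c) ≤ maxWidthGap c K ε +
      3 * ((1 + 1 / c) * ε) * Real.sqrt (localEntropy c K ε) := by
  obtain ⟨S, hSne, hSK, hScov, hScard⟩ := exists_finset_cover hc hε hμ
  have hεc : 0 ≤ ε / c := by positivity
  have hl : 0 < (1 + 1 / c) * ε := by positivity
  have hlip : ∀ p ∈ S, LipschitzWith ((1 + 1 / c) * ε).toNNReal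
      (fun x => inner ℝ x (p - μ) + localSup K p (ε / c) x) := by
    intro p hp
    refine LipschitzWith.of_le_add_mul _ fun x y => ?_
    rw [Real.coe_toNNReal _ hl.le, dist_eq_norm]
    have h1 := inner_sub_le_of_mem_closedBall (hSK p hp).1 (x - y)
    rw [inner_sub_left] at h1
    have h2 := (le_abs_self _).trans
      ((lipschitzWith_localSup (hSK p hp).2 hεc).sub_le_mul_norm x y)
    rw [Real.coe_toNNReal _ hεc] at h2
    have h3 : (1 + 1 / c) * ε * ‖x - y‖ = ε * ‖x - y‖ + ε / c * ‖x - y‖ := by ring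
    linarith
  have hint : ∀ p ∈ S, ∫ x, (inner ℝ x (p - μ) + localSup K p (ε / c) x)
      ∂(stdGaussian (EuclideanSpace ℝ (Fin n))) ≤
      localWidth K μ (ε / c) + maxWidthGap c K ε := by
    intro p hp
    rw [integral_add (integrable_inner_stdGaussian _) (integrable_localSup (hSK p hp).2 hεc),
      integral_inner_stdGaussian, zero_add, ← localWidth_eq (hSK p hp).2 hεc]
    have hd : ‖p - μ‖ ≤ 2 * ε := by
      have := mem_closedBall_iff_norm.1 (hSK p hp).1
      linarith
    linarith [le_maxWidthGap hc hε.le (hSK p hp).2 hμ hd]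
  -- The index may depend on `x` but not on `t`, hence the maximiser over all centres.
  have hg : ∀ x, ∃ p ∈ S, localSup K μ ε x ≤ inner ℝ x (p - μ) + localSup K p (ε / c) x := by
    intro x
    obtain ⟨q, hq, hmax⟩ := S.exists_max_image
      (fun p => inner ℝ x (p - μ) + localSup K p (ε / c) x) hSne
    refine ⟨q, hq, localSup_le hμ hε.le fun t ht htK => ?_⟩
    obtain ⟨p, hp, htp⟩ := hScov t ⟨ht, htK⟩
    refine le_trans ?_ (hmax p hp)
    have := le_localSup htp htK x
    rw [inner_sub_right] at this ⊢
    rw [inner_sub_right]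
    linarith
  have h := integral_le_add_mul_sqrt_log_card S hSne (Real.toNNReal_pos.2 hl) hlip
    (integrable_localSup hμ hε.le) hint hg
  rw [← localWidth_eq hμ hε.le, Real.coe_toNNReal _ hl.le] at h
  have h2 : 3 * ((1 + 1 / c) * ε) * Real.sqrt (Real.log S.card) ≤
      3 * ((1 + 1 / c) * ε) * Real.sqrt (localEntropy c K ε) := by
    gcongr
  linarith

/-- If the risk at `μ` is large, the local width grows quickly at the radius `√risk`. -/
theorem le_localWidth_sub (hcl : IsClosed K) (hK : Convex ℝ K) {c : ℝ} (hc : 1 < c) {σ : ℝ}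
    (hσ : 0 < σ) {μ : EuclideanSpace ℝ (Fin n)} (hμ : μ ∈ K) {ε : ℝ} (hε : 0 < ε)
    (hR : lseRisk K σ μ = ε ^ 2) (hA : 16 / (1 - 1 / c) ^ 2 * σ ≤ ε) :
    (1 - 1 / c ^ 2) * ε ^ 2 / (2 * σ) ≤ localWidth K μ ε - localWidth K μ (ε / c) := by
  have hne : K.Nonempty := ⟨μ, hμ⟩
  have hc0 : 0 < c := by linarith
  have hεc : 0 ≤ ε / c := by positivity
  have hεc' : ε / c ≤ ε := div_le_self hε.le hc.le
  set δ := 1 - 1 / c with hδ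
  have hδ0 : 0 < δ := by
    rw [hδ, sub_pos, div_lt_one hc0]; exact hc
  have hδ1 : δ < 1 := by
    have : 0 < 1 / c := by positivity
    linarith
  have hlip := lipschitzWith_lseLoss hne hcl hK hσ μ
  have hZi := hlip.integrable_stdGaussian
  have hZ2 := integrable_lseLoss_sq hne hcl hK hσ μ
  rw [lseRisk_eq] at hR
  set m := ∫ x, lseLoss K σ μ x ∂(stdGaussian (EuclideanSpace ℝ (Fin n))) with hm
  have hm0 : 0 ≤ m := integral_nonneg fun x => norm_nonneg _
  have hsq : ∀ a : ℝ, ∫ x, (lseLoss K σ μ x - a) ^ 2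
      ∂(stdGaussian (EuclideanSpace ℝ (Fin n))) = ε ^ 2 - 2 * a * m + a ^ 2 := by
    intro a
    have e : ∀ x, (lseLoss K σ μ x - a) ^ 2 =
        lseLoss K σ μ x ^ 2 - 2 * a * lseLoss K σ μ x + a ^ 2 := fun x => by ring
    simp_rw [e]
    have hi : Integrable (fun x => lseLoss K σ μ x ^ 2 - 2 * a * lseLoss K σ μ x)
        (stdGaussian (EuclideanSpace ℝ (Fin n))) := hZ2.sub (hZi.const_mul _)
    rw [integral_add hi (integrable_const _),
      integral_sub hZ2 (hZi.const_mul _), hR, integral_const_mul]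
    simp [hm]
  have hvar := hlip.integral_sq_sub_integral_le (Real.toNNReal_pos.2 hσ)
  rw [← hm, hsq, Real.coe_toNNReal _ hσ.le] at hvar
  have hmε : m ≤ ε := by
    have h0 : 0 ≤ ∫ x, (lseLoss K σ μ x - m) ^ 2
      ∂(stdGaussian (EuclideanSpace ℝ (Fin n))) := integral_nonneg fun x => sq_nonneg _
    rw [hsq] at h0
    exact le_of_sq_le_sq (by linarith) hε.le
  set V := ε ^ 2 - 2 * ε * m + ε ^ 2 with hV
  -- `V = 2ε(ε - m) ≤ 2(ε² - m²)`, twice the variance of the loss: the loss is close to `ε` in mean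
  -- square.
  have hV' : V ≤ 32 * σ ^ 2 := by nlinarith
  set w := 1 + 1 / δ ^ 2 with hw
  -- A lower bound for `Z (min Z ε - ε/c)` with the minimum traded for squares; the weight `1/δ²` in
  -- `w` comes from splitting `ε|Z - ε|`.
  have hpt : ∀ x, lseLoss K σ μ x ^ 2 - w * (lseLoss K σ μ x - ε) ^ 2 - δ ^ 2 * ε ^ 2 / 4
      - ε / c * lseLoss K σ μ x ≤ σ * (localSup K μ ε x - localSup K μ (ε / c) x) := by
    intro x
    have h := localSup_add_le hcl hK hσ hμ hεc hεc' x
    have hZ0 : 0 ≤ lseLoss K σ μ x := norm_nonneg _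
    set Z := lseLoss K σ μ x
    have h1 : Z * (min Z ε - ε / c) ≤ σ * (localSup K μ ε x - localSup K μ (ε / c) x) := by
      have h2 : Z / σ * (min Z ε - ε / c) ≤ localSup K μ ε x - localSup K μ (ε / c) x := by
        linarith
      calc Z * (min Z ε - ε / c) = σ * (Z / σ * (min Z ε - ε / c)) := by field_simp
        _ ≤ _ := by gcongr
    refine le_trans ?_ h1
    have h3 : ε * |Z - ε| ≤ δ ^ 2 * ε ^ 2 / 4 + 1 / δ ^ 2 * (Z - ε) ^ 2 := by
      rw [← sq_abs (Z - ε)]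
      have : δ ^ 2 * ε ^ 2 / 4 + 1 / δ ^ 2 * |Z - ε| ^ 2 - ε * |Z - ε| =
        (δ * ε / 2 - |Z - ε| / δ) ^ 2 := by field_simp; ring
      nlinarith [sq_nonneg (δ * ε / 2 - |Z - ε| / δ)]
    have h4 : Z ^ 2 - (Z - ε) ^ 2 - ε * |Z - ε| ≤ Z * min Z ε := by
      rcases le_total Z ε with h5 | h5
      · rw [min_eq_left h5]
        nlinarith [mul_nonneg hε.le (abs_nonneg (Z - ε))]
      · rw [min_eq_right h5, abs_of_nonneg (by linarith)]
        nlinarith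
    rw [hw]
    nlinarith
  have hFi := integrable_localSup (K := K) hμ hε.le
  have hFci := integrable_localSup (K := K) hμ hεc
  have hVi := hlip.integrable_sq_sub_stdGaussian ε
  have i1 : Integrable (fun x => lseLoss K σ μ x ^ 2 - w * (lseLoss K σ μ x - ε) ^ 2)
      (stdGaussian (EuclideanSpace ℝ (Fin n))) := hZ2.sub (hVi.const_mul w)
  have i2 : Integrable (fun x => lseLoss K σ μ x ^ 2 - w * (lseLoss K σ μ x - ε) ^ 2
      - δ ^ 2 * ε ^ 2 / 4) (stdGaussian (EuclideanSpace ℝ (Fin n))) :=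
    i1.sub (integrable_const _)
  have h := integral_mono (i2.sub (hZi.const_mul (ε / c)))
    ((hFi.sub hFci).const_mul σ) hpt
  simp only [Pi.sub_apply] at h
  rw [integral_sub i2 (hZi.const_mul _), integral_sub i1 (integrable_const _),
    integral_sub hZ2 (hVi.const_mul w), integral_const_mul, integral_const_mul,
    integral_const_mul, integral_sub hFi hFci, hsq, hR, ← hm, ← hV, ← localWidth_eq hμ hε.le,
    ← localWidth_eq hμ hεc] at h
  simp only [integral_const, probReal_univ, one_smul] at h
  have hw0 : 0 ≤ w := by rw [hw]; positivity
  have h6 : w * V ≤ w * (32 * σ ^ 2) := by gcongr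
  -- The constant `16/δ²` in the hypothesis on `ε` is chosen for this step, where `w ≤ 2/δ²`.
  have h7 : w * (32 * σ ^ 2) ≤ δ ^ 2 * ε ^ 2 / 4 := by
    have h8 : 16 * σ ≤ δ ^ 2 * ε := by
      rw [div_mul_eq_mul_div, div_le_iff₀ (by positivity)] at hA
      linarith
    have h9 : (16 * σ) ^ 2 ≤ (δ ^ 2 * ε) ^ 2 := by gcongr
    have h10 : w * δ ^ 2 = δ ^ 2 + 1 := by rw [hw]; field_simp
    have h11 : δ ^ 2 ≤ 1 := by nlinarith
    have h12 : δ ^ 2 * (w * (32 * σ ^ 2)) ≤ δ ^ 2 * (δ ^ 2 * ε ^ 2 / 4) := by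
      calc δ ^ 2 * (w * (32 * σ ^ 2)) = (w * δ ^ 2) * (32 * σ ^ 2) := by ring
        _ ≤ 2 * (32 * σ ^ 2) := by rw [h10]; gcongr; linarith
        _ ≤ _ := by nlinarith
    exact le_of_mul_le_mul_left h12 (by positivity)
  have h13 : ε / c * m ≤ ε / c * ε := by gcongr
  rw [div_le_iff₀ (by positivity)]
  -- The two errors `δ²ε²/4` are affordable because `2(δ - δ²/2) = 1 - (1 - δ)² = 1 - 1/c²`.
  have h14 : (1 - 1 / c ^ 2) * ε ^ 2 = 2 * (ε ^ 2 - δ ^ 2 * ε ^ 2 / 2 - ε / c * ε) := by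
    rw [hδ]; field_simp; ring
  linarith

/-- The noise level `σ'` turns the penalty into exactly the lower bound of `le_localWidth_sub`, and
`L ≥ 3(c + 1)` absorbs the constant of the maximal inequality. -/
theorem sqrt_lseRisk_le_epsBar (hcl : IsClosed K) (hK : Convex ℝ K) {c L : ℝ} (hc : 1 < c)
    (hL : 3 * (c + 1) ≤ L) {σ : ℝ} (hσ : 0 < σ) {μ : EuclideanSpace ℝ (Fin n)} (hμ : μ ∈ K)
    (hA : 16 / (1 - 1 / c) ^ 2 * σ ≤ Real.sqrt (lseRisk K σ μ)) :
    Real.sqrt (lseRisk K σ μ) ≤ epsBar c L K (widthConst c * σ / (1 - 1 / c ^ 2)) := by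
  have hc0 : 0 < c := by linarith
  have hcc : 0 < 1 - 1 / c ^ 2 := by
    rw [sub_pos, div_lt_one (by positivity)]; nlinarith
  have hc1 : 0 < 1 - 1 / c := by
    rw [sub_pos, div_lt_one hc0]; exact hc
  have hC : 0 < widthConst c := by rw [widthConst_eq]; positivity
  have hR := (Real.sq_sqrt (lseRisk_nonneg K σ μ)).symm
  set ε := Real.sqrt (lseRisk K σ μ) with hε
  have hε0 : 0 < ε := lt_of_lt_of_le (by positivity) hA
  have h1 := le_localWidth_sub hcl hK hc hσ hμ hε0 hR hA
  have h2 := localWidth_sub_le hc0 hε0 hμ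
  refine le_epsBar ⟨μ, hμ⟩ hc0 (by linarith) (by positivity) hε0.le ?_
  have h3 : widthConst c * ε ^ 2 / (2 * (widthConst c * σ / (1 - 1 / c ^ 2))) =
      (1 - 1 / c ^ 2) * ε ^ 2 / (2 * σ) := by field_simp
  have h4 : 3 * ((1 + 1 / c) * ε) * Real.sqrt (localEntropy c K ε) ≤
      L / c * ε * Real.sqrt (localEntropy c K ε) := by
    have : 3 * (1 + 1 / c) ≤ L / c := by
      rw [le_div_iff₀ hc0]
      have : 3 * (1 + 1 / c) * c = 3 * (c + 1) := by field_simp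
      linarith
    calc _ = 3 * (1 + 1 / c) * ε * Real.sqrt (localEntropy c K ε) := by ring
      _ ≤ _ := by gcongr
  rw [h3]
  linarith

end UpperBound

/-! ### Lower bounds from width gaps, from entropy and from two points. -/

section LowerBound

variable {n : ℕ} {K : Set (EuclideanSpace ℝ (Fin n))}

/-- A large difference of local widths forces a large risk. -/
theorem le_lseRisk_of_localWidth_sub (hcl : IsClosed K) (hK : Convex ℝ K) {c : ℝ} (hc : 1 < c)
    {σ : ℝ} (hσ : 0 < σ) {μ ν : EuclideanSpace ℝ (Fin n)} (hμ : μ ∈ K) (hν : ν ∈ K) {ε : ℝ}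
    (hε : 0 < ε) (hA : 64 * σ ≤ ε) (hνμ : ‖ν - μ‖ ≤ 2 * ε)
    (h : ε ^ 2 / σ ≤ localWidth K ν (ε / c) - localWidth K μ (ε / c)) :
    ε ^ 2 / (64 * c ^ 2) ≤ lseRisk K σ μ := by
  have hne : K.Nonempty := ⟨μ, hμ⟩
  have hc0 : 0 < c := by linarith
  set r := ε / c with hr
  have hr0 : 0 < r := by positivity
  have hrε : r ≤ ε := div_le_self hε.le hc.le
  set s := r + 2 * ε with hs
  have hs0 : 0 ≤ s := by positivity
  have hrs : r ≤ s := by linarith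
  have hw := localWidth_le_localWidth (s := s) hμ hν hr0.le (by linarith)
  set G := fun x => localSup K μ s x - localSup K μ r x with hG
  have hFs := integrable_localSup (K := K) hμ hs0
  have hFr := integrable_localSup (K := K) hμ hr0.le
  have hGlip : LipschitzWith (4 * ε).toNNReal G := by
    refine LipschitzWith.of_le_add_mul _ fun x y => ?_
    rw [Real.coe_toNNReal _ (by positivity), dist_eq_norm]
    have h1 := (lipschitzWith_localSup (K := K) hμ hs0).sub_le_mul_norm x y
    have h2 := (lipschitzWith_localSup (K := K) hμ hr0.le).sub_le_mul_norm x y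
    rw [Real.coe_toNNReal _ hs0] at h1
    rw [Real.coe_toNNReal _ hr0.le] at h2
    have h3 : s * ‖x - y‖ + r * ‖x - y‖ ≤ 4 * ε * ‖x - y‖ := by
      rw [← add_mul]; gcongr; linarith
    simp only [hG]
    linarith [(abs_le.1 h1).2, (abs_le.1 h2).1]
  have hGi := hGlip.integrable_stdGaussian
  set g := ∫ x, G x ∂(stdGaussian (EuclideanSpace ℝ (Fin n))) with hg
  have hgval : ε ^ 2 / σ ≤ g := by
    rw [hg]
    simp only [hG]
    rw [integral_sub hFs hFr, ← localWidth_eq hμ hs0, ← localWidth_eq hμ hr0.le]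
    linarith
  have hg0 : 0 < g := lt_of_lt_of_le (by positivity) hgval
  have hlip := lipschitzWith_lseLoss hne hcl hK hσ μ
  have hZi := hlip.integrable_stdGaussian
  have hZ2 := integrable_lseLoss_sq hne hcl hK hσ μ
  have hdev := hGlip.integral_abs_sub_integral_le (Real.toNNReal_pos.2 (by positivity))
  rw [← hg, Real.coe_toNNReal _ (by positivity)] at hdev
  -- If `Z < r`, the slope above `Z` controls `G`; if `Z ≥ r`, then `G ≤ g + |G - g|` and `g ≤ g
  -- Z²/r²`.
  have hpt : ∀ x, G x ≤ 2 * ε / σ * lseLoss K σ μ x + g / r ^ 2 * lseLoss K σ μ x ^ 2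
      + |G x - g| := by
    intro x
    have hZ0 : 0 ≤ lseLoss K σ μ x := norm_nonneg _
    rcases lt_or_ge (lseLoss K σ μ x) r with h1 | h1
    · have h2 := localSup_le_add hcl hK hσ hμ hr0.le hrs x h1
      have h3 : G x ≤ 2 * ε / σ * lseLoss K σ μ x := by
        have : lseLoss K σ μ x / σ * (s - r) = 2 * ε / σ * lseLoss K σ μ x := by
          rw [hs]; ring
        simp only [hG]
        linarith
      have h4 : 0 ≤ g / r ^ 2 * lseLoss K σ μ x ^ 2 := by positivity
      linarith [abs_nonneg (G x - g)]
    · have h2 : g ≤ g / r ^ 2 * lseLoss K σ μ x ^ 2 := by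
        calc g = g / r ^ 2 * r ^ 2 := by field_simp
          _ ≤ _ := by gcongr
      have h3 : 0 ≤ 2 * ε / σ * lseLoss K σ μ x := by positivity
      linarith [le_abs_self (G x - g)]
  have hdi : Integrable (fun x => |G x - g|) (stdGaussian (EuclideanSpace ℝ (Fin n))) :=
    (hGi.sub (integrable_const g)).abs
  have i1 : Integrable (fun x => 2 * ε / σ * lseLoss K σ μ x + g / r ^ 2 * lseLoss K σ μ x ^ 2)
      (stdGaussian (EuclideanSpace ℝ (Fin n))) := (hZi.const_mul _).add (hZ2.const_mul _)
  have hI := integral_mono hGi (i1.add hdi) hpt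
  simp only [Pi.add_apply] at hI
  rw [integral_add i1 hdi, integral_add (hZi.const_mul _) (hZ2.const_mul _),
    integral_const_mul, integral_const_mul, ← lseRisk_eq, ← hg] at hI
  set R := lseRisk K σ μ with hR
  set m := ∫ x, lseLoss K σ μ x ∂(stdGaussian (EuclideanSpace ℝ (Fin n))) with hm
  have hm2 : m ≤ 4 / ε * R + ε / 16 := by
    have hp : ∀ x, lseLoss K σ μ x ≤ 4 / ε * lseLoss K σ μ x ^ 2 + ε / 16 := by
      intro x
      set Z := lseLoss K σ μ x
      have : 4 / ε * Z ^ 2 + ε / 16 - Z = 4 / ε * (Z - ε / 8) ^ 2 := by field_simp; ring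
      have h2 : 0 ≤ 4 / ε * (Z - ε / 8) ^ 2 := by positivity
      linarith
    have h2 := integral_mono hZi ((hZ2.const_mul (4 / ε)).add (integrable_const (ε / 16))) hp
    simp only [Pi.add_apply] at h2
    rw [integral_add (hZ2.const_mul _) (integrable_const _), integral_const_mul, ← lseRisk_eq] at h2
    simpa using h2
  -- With risk below `r²/64` the three terms on the right are at most `g/4`, `g/64` and `g/4`; the
  -- last, `16ε`, needs `64σ ≤ ε`.
  by_contra! hcon
  have hR0 : 0 ≤ R := lseRisk_nonneg K σ μ
  have hRr : R < r ^ 2 / 64 := by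
    refine hcon.trans_eq ?_
    rw [hr]; field_simp
  have hRε : R < ε ^ 2 / 64 := hRr.trans_le (by gcongr)
  have t1 : g / r ^ 2 * R ≤ g / 64 := by
    calc g / r ^ 2 * R ≤ g / r ^ 2 * (r ^ 2 / 64) := by gcongr
      _ = g / 64 := by field_simp
  have t2 : m ≤ ε / 8 := by
    have : 4 / ε * R ≤ 4 / ε * (ε ^ 2 / 64) := by gcongr
    have e : 4 / ε * (ε ^ 2 / 64) = ε / 16 := by field_simp; norm_num
    linarith
  have t3 : 2 * ε / σ * m ≤ (ε ^ 2 / σ) / 4 := by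
    calc 2 * ε / σ * m ≤ 2 * ε / σ * (ε / 8) := by gcongr
      _ = (ε ^ 2 / σ) / 4 := by ring
  have t4 : 4 * (4 * ε) ≤ (ε ^ 2 / σ) / 4 := by
    rw [div_div, le_div_iff₀ (by positivity)]
    nlinarith
  linarith

theorem measurable_lse (hne : K.Nonempty) (hcl : IsClosed K) (hK : Convex ℝ K) :
    Measurable (lse K) := by
  have : LipschitzWith 1 (lse K) := LipschitzWith.of_dist_le_mul fun x y => by
    simpa [dist_eq_norm] using norm_lse_sub_lse_le hne hcl hK x y
  exact this.continuous.measurable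

theorem measureReal_le_lseLoss_le (hne : K.Nonempty) (hcl : IsClosed K) (hK : Convex ℝ K)
    {σ : ℝ} (hσ : 0 < σ) (p : EuclideanSpace ℝ (Fin n)) {ρ : ℝ} (hρ : 0 < ρ) :
    (stdGaussian (EuclideanSpace ℝ (Fin n))).real {x | ρ ≤ lseLoss K σ p x} ≤
      lseRisk K σ p / ρ ^ 2 := by
  rw [le_div_iff₀ (by positivity), lseRisk_eq, mul_comm]
  refine le_trans ?_ (mul_meas_ge_le_integral_of_nonneg
    (.of_forall fun x => sq_nonneg (lseLoss K σ p x))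
    (integrable_lseLoss_sq hne hcl hK hσ p) (ρ ^ 2))
  refine mul_le_mul_of_nonneg_left (measureReal_mono fun x hx => ?_) (by positivity)
  exact pow_le_pow_left₀ hρ.le hx 2

/-- If the risk at `p` is small, the estimator is close to `p` with a probability that is not too
small under any nearby parameter `θ`. -/
theorem one_div_four_le_exp_mul_measureReal (hne : K.Nonempty) (hcl : IsClosed K)
    (hK : Convex ℝ K) {σ : ℝ} (hσ : 0 < σ) (θ p : EuclideanSpace ℝ (Fin n)) {ρ : ℝ}
    (hρ : 0 < ρ) (hR : lseRisk K σ p ≤ ρ ^ 2 / 2) :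
    1 / 4 ≤ Real.exp ((‖p - θ‖ / σ) ^ 2) * (stdGaussian (EuclideanSpace ℝ (Fin n))).real
      {x | ‖lse K (θ + σ • x) - p‖ < ρ} := by
  have hm := measurable_lse hne hcl hK
  have hA : MeasurableSet {x : EuclideanSpace ℝ (Fin n) | ‖lse K (θ + σ • x) - p‖ < ρ} :=
    measurableSet_lt (by fun_prop) measurable_const
  have h := stdGaussian_preimage_add_right_sq_le (σ⁻¹ • (p - θ)) hA
  -- Shifting the noise by `(p - θ)/σ` turns an observation with mean `θ` into one with mean `p`,
  -- where Markov's inequality gives probability at least `1/2`.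
  have hpre : (fun x => x + σ⁻¹ • (p - θ)) ⁻¹' {x | ‖lse K (θ + σ • x) - p‖ < ρ} =
      {x | ρ ≤ lseLoss K σ p x}ᶜ := by
    ext x
    simp only [Set.mem_preimage, Set.mem_ofPred_eq, Set.mem_compl_iff, not_le, lseLoss]
    rw [smul_add, smul_inv_smul₀ hσ.ne']
    rw [show θ + (σ • x + (p - θ)) = p + σ • x by abel]
  have hB : MeasurableSet {x | ρ ≤ lseLoss K σ p x} :=
    measurableSet_le measurable_const
      (lipschitzWith_lseLoss hne hcl hK hσ p).continuous.measurable
  rw [hpre, probReal_compl_eq_one_sub hB, norm_smul, norm_inv, Real.norm_of_nonneg hσ.le,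
    inv_mul_eq_div] at h
  refine le_trans ?_ h
  have h1 := measureReal_le_lseLoss_le hne hcl hK hσ p hρ
  have h2 : lseRisk K σ p / ρ ^ 2 ≤ 1 / 2 := by
    rw [div_le_iff₀ (by positivity)]; linarith
  nlinarith

/-- A risk bound limits the cardinality of local packings. -/
theorem card_le_of_lseRisk_le (hne : K.Nonempty) (hcl : IsClosed K) (hK : Convex ℝ K) {σ : ℝ}
    (hσ : 0 < σ) (θ : EuclideanSpace ℝ (Fin n)) {ι : Type*} (S : Finset ι)
    (q : ι → EuclideanSpace ℝ (Fin n)) {r ρ : ℝ} (hρ : 0 < ρ) (hr : ∀ i ∈ S, ‖q i - θ‖ ≤ r)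
    (hsep : (S : Set ι).Pairwise fun i j => 2 * ρ ≤ ‖q i - q j‖)
    (hR : ∀ i ∈ S, lseRisk K σ (q i) ≤ ρ ^ 2 / 2) :
    (S.card : ℝ) ≤ 4 * Real.exp ((r / σ) ^ 2) := by
  set A : ι → Set (EuclideanSpace ℝ (Fin n)) :=
    fun i => {x | ‖lse K (θ + σ • x) - q i‖ < ρ} with hA
  have hm := measurable_lse hne hcl hK
  have hAm : ∀ i ∈ S, MeasurableSet (A i) := fun i _ =>
    measurableSet_lt (by fun_prop) measurable_const
  have hdisj : (S : Set ι).PairwiseDisjoint A := by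
    intro i hi j hj hij
    refine Set.disjoint_left.2 fun x hxi hxj => ?_
    have h1 : 2 * ρ ≤ ‖q i - q j‖ := hsep hi hj hij
    have h2 := norm_sub_le_norm_sub_add_norm_sub (q i) (lse K (θ + σ • x)) (q j)
    rw [norm_sub_rev (q i) (lse K (θ + σ • x))] at h2
    simp only [hA, Set.mem_ofPred_eq] at hxi hxj
    linarith
  have hsum := measureReal_biUnion_finset (μ := stdGaussian (EuclideanSpace ℝ (Fin n)))
    hdisj hAm
  have hle1 : ∑ i ∈ S, (stdGaussian (EuclideanSpace ℝ (Fin n))).real (A i) ≤ 1 := by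
    rw [← hsum]; exact measureReal_le_one
  have hi : ∀ i ∈ S, 1 / 4 ≤ Real.exp ((r / σ) ^ 2) *
      (stdGaussian (EuclideanSpace ℝ (Fin n))).real (A i) := by
    intro i hi
    refine (one_div_four_le_exp_mul_measureReal hne hcl hK hσ θ (q i) hρ (hR i hi)).trans ?_
    have := hr i hi
    gcongr
  have h := Finset.sum_le_sum hi
  rw [Finset.sum_const, nsmul_eq_mul, ← Finset.mul_sum] at h
  have h2 : Real.exp ((r / σ) ^ 2) * ∑ i ∈ S, (stdGaussian (EuclideanSpace ℝ (Fin n))).real (A i)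
      ≤ Real.exp ((r / σ) ^ 2) * 1 := by gcongr
  linarith

/-- A large local entropy forces a large worst case rate. -/
theorem le_worstCaseRate_of_localEntropy (hne : K.Nonempty) (hcl : IsClosed K)
    (hK : Convex ℝ K) {c s σ ε : ℝ} (hc : 1 < c) (hs : 0 < s) (hs1 : s ≤ 1) (hσ : 0 < σ)
    (hε : 0 < ε) (hA : σ ≤ s * ε) (h : 4 * (s * ε / σ) ^ 2 ≤ localEntropy c K ε) :
    s * ε / (4 * c) ≤ worstCaseRate K σ := by
  have hc0 : 0 < c := by linarith
  by_contra! hcon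
  have hrate : 0 ≤ worstCaseRate K σ := Real.sqrt_nonneg _
  have hu : 1 ≤ s * ε / σ := (one_le_div hσ).2 hA
  have hpos : 0 < localEntropy c K ε := lt_of_lt_of_le (by positivity) h
  have hM : 0 < (localPacking c K ε).toNat := by
    by_contra! h0
    rw [localEntropy, Nat.le_zero.1 h0] at hpos
    simp at hpos
  obtain ⟨θ, hθ, S, hcard, hSK, hsep⟩ := exists_finset_packing hc0 hε hM
  -- Shrinking the packing towards `θ` stays in `K` by convexity. It scales the cost of the change
  -- of measure by `s²`, so an entropy of order `(sε/σ)²` suffices.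
  have hq : ∀ p ∈ S, θ + s • (p - θ) ∈ K := fun p hp => by
    have := hK hθ (hSK p hp).2 (sub_nonneg.2 hs1) hs.le (by ring)
    convert this using 1
    module
  have hb := card_le_of_lseRisk_le hne hcl hK hσ θ S (fun p => θ + s • (p - θ)) (r := s * ε)
    (ρ := s * ε / (2 * c)) (by positivity)
    (fun p hp => by
      have := mem_closedBall_iff_norm.1 (hSK p hp).1
      rw [add_sub_cancel_left, norm_smul, Real.norm_of_nonneg hs.le]
      gcongr)
    (fun p hp p' hp' hpp' => by
      have h1 : ε / c < dist p p' := hsep hp hp' hpp'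
      rw [dist_eq_norm] at h1
      dsimp only
      rw [add_sub_add_left_eq_sub, ← smul_sub, sub_sub_sub_cancel_right, norm_smul,
        Real.norm_of_nonneg hs.le]
      calc 2 * (s * ε / (2 * c)) = s * (ε / c) := by field_simp
        _ ≤ _ := by gcongr)
    (fun p hp => by
      refine (lseRisk_le_worstCaseRate_sq hne hcl hK hσ (hq p hp)).trans ?_
      calc worstCaseRate K σ ^ 2 ≤ (s * ε / (4 * c)) ^ 2 := by gcongr
        _ = (s * ε / (2 * c)) ^ 2 / 4 := by field_simp; norm_num
        _ ≤ _ := by gcongr; norm_num)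
  rw [hcard] at hb
  set u := (s * ε / σ) ^ 2 with hu'
  have hu1 : 1 ≤ u := one_le_pow₀ hu
  have h1 : Real.exp (4 * u) ≤ (localPacking c K ε).toNat := by
    rw [← Real.le_log_iff_exp_le (by exact_mod_cast hM)]
    exact h
  have h2 : Real.exp (4 * u) = Real.exp (3 * u) * Real.exp u := by
    rw [← Real.exp_add]; congr 1; ring
  -- The packing has at least `exp (4u)` and at most `4 exp u` points, which is impossible for `u ≥
  -- 1`.
  have h3 : Real.exp (3 * u) ≤ 4 := by
    refine le_of_mul_le_mul_right ?_ (Real.exp_pos u)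
    linarith
  have h4 := Real.quadratic_le_exp_of_nonneg (x := 3 * u) (by positivity)
  nlinarith

/-- The two-point lower bound. -/
theorem minDiam_le_worstCaseRate (hne : K.Nonempty) (hcl : IsClosed K) (hK : Convex ℝ K) {σ : ℝ}
    (hσ : 0 < σ) : 1 / 16 * minDiam K σ ≤ worstCaseRate K σ := by
  have hrate : 0 ≤ worstCaseRate K σ := Real.sqrt_nonneg _
  have hm0 : 0 ≤ minDiam K σ := ENNReal.toReal_nonneg
  have hmtop : min (ENNReal.ofReal σ) (Metric.ediam K) ≠ ⊤ :=
    ne_top_of_le_ne_top ENNReal.ofReal_ne_top (min_le_left _ _)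
  have hmσ : minDiam K σ ≤ σ := by
    have := ENNReal.toReal_mono ENNReal.ofReal_ne_top
      (min_le_left (ENNReal.ofReal σ) (Metric.ediam K))
    rwa [ENNReal.toReal_ofReal hσ.le] at this
  have hmd : ENNReal.ofReal (minDiam K σ) ≤ Metric.ediam K := by
    rw [minDiam, ENNReal.ofReal_toReal hmtop]
    exact min_le_right _ _
  set m := minDiam K σ with hm
  rcases hm0.eq_or_lt with h0 | h0
  · rw [← h0, mul_zero]; exact hrate
  obtain ⟨p, hp, q, hq, hpq⟩ : ∃ p ∈ K, ∃ q ∈ K, m / 2 < dist p q := by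
    by_contra! hcon
    have : Metric.ediam K ≤ ENNReal.ofReal (m / 2) := by
      refine Metric.ediam_le fun x hx y hy => ?_
      rw [edist_dist]
      exact ENNReal.ofReal_le_ofReal (hcon x hx y hy)
    have h2 := (ENNReal.ofReal_le_ofReal_iff (by positivity)).1 (hmd.trans this)
    linarith
  rw [dist_comm, dist_eq_norm] at hpq
  -- The second point is placed at distance exactly `m/2 ≤ σ/2` from `p`: the change of measure
  -- costs a factor at most `3`, and the open balls of radius `m/4` are disjoint.
  set a := m / 2 / ‖q - p‖ with ha
  have hd : 0 < ‖q - p‖ := by linarith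
  have ha0 : 0 ≤ a := by positivity
  have ha1 : a ≤ 1 := (div_le_one hd).2 hpq.le
  set w := p + a • (q - p) with hw
  have hwK : w ∈ K := by
    have := hK hp hq (sub_nonneg.2 ha1) ha0 (by ring)
    convert this using 1
    rw [hw]
    module
  have hwp : ‖w - p‖ = m / 2 := by
    rw [hw, add_sub_cancel_left, norm_smul, Real.norm_of_nonneg ha0, ha]
    exact div_mul_cancel₀ _ hd.ne'
  by_contra! hcon
  have hrisk : ∀ μ ∈ K, lseRisk K σ μ < (m / 16) ^ 2 := fun μ hμ => by
    refine (lseRisk_le_worstCaseRate_sq hne hcl hK hσ hμ).trans_lt ?_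
    exact pow_lt_pow_left₀ (by linarith) hrate two_ne_zero
  have h1 := one_div_four_le_exp_mul_measureReal hne hcl hK hσ p w (ρ := m / 4) (by positivity)
    (by nlinarith [hrisk w hwK])
  have h2 := measureReal_le_lseLoss_le hne hcl hK hσ p (ρ := m / 4) (by positivity)
  have h3 : (stdGaussian (EuclideanSpace ℝ (Fin n))).real {x | ‖lse K (p + σ • x) - w‖ < m / 4} ≤
      (stdGaussian (EuclideanSpace ℝ (Fin n))).real {x | m / 4 ≤ lseLoss K σ p x} := by
    refine measureReal_mono fun x hx => ?_
    simp only [Set.mem_ofPred_eq, lseLoss] at hx ⊢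
    have := norm_sub_le_norm_sub_add_norm_sub w (lse K (p + σ • x)) p
    rw [norm_sub_rev w (lse K (p + σ • x))] at this
    linarith
  have h4 : lseRisk K σ p / (m / 4) ^ 2 < 1 / 16 := by
    rw [div_lt_iff₀ (by positivity)]
    nlinarith [hrisk p hp]
  have h5 : Real.exp ((‖w - p‖ / σ) ^ 2) ≤ 3 := by
    have : (‖w - p‖ / σ) ^ 2 ≤ 1 := by
      rw [hwp]
      have h6 : m / 2 / σ ≤ 1 := (div_le_one hσ).2 (by linarith)
      exact pow_le_one₀ (by positivity) h6
    exact (Real.exp_le_exp.2 this).trans Real.exp_one_lt_three.le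
  have h6 : (stdGaussian (EuclideanSpace ℝ (Fin n))).real
      {x | ‖lse K (p + σ • x) - w‖ < m / 4} ≤ 1 / 16 := by linarith
  have h7 : Real.exp ((‖w - p‖ / σ) ^ 2) * (stdGaussian (EuclideanSpace ℝ (Fin n))).real
      {x | ‖lse K (p + σ • x) - w‖ < m / 4} ≤ 3 * (1 / 16) := by gcongr
  linarith

/-- For `d ≤ σ` the loss is at most `d`, because the estimator lies in `K`; this is where `κ ≥ 1`
enters. -/
theorem worstCaseRate_le_mul_minDiam (hne : K.Nonempty) (hcl : IsClosed K) {σ κ : ℝ}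
    (hκ : 1 ≤ κ) (hσ : 0 < σ) (h : worstCaseRate K σ ≤ κ * σ) :
    worstCaseRate K σ ≤ κ * minDiam K σ := by
  rcases le_total (ENNReal.ofReal σ) (Metric.ediam K) with hle | hle
  · rwa [minDiam, min_eq_left hle, ENNReal.toReal_ofReal hσ.le]
  · rw [minDiam, min_eq_right hle]
    have htop : Metric.ediam K ≠ ⊤ := ne_top_of_le_ne_top ENNReal.ofReal_ne_top hle
    set d := (Metric.ediam K).toReal with hd
    have hd0 : 0 ≤ d := ENNReal.toReal_nonneg
    have hloss : ∀ μ ∈ K, ∀ x, lseLoss K σ μ x ≤ d := by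
      intro μ hμ x
      have h1 := Metric.edist_le_ediam_of_mem (lse_spec hne hcl (μ + σ • x)).1 hμ
      rw [lseLoss, ← dist_eq_norm, dist_edist]
      exact ENNReal.toReal_mono htop h1
    have : worstCaseRate K σ ≤ d := by
      refine worstCaseRate_le hne hd0 fun μ hμ => ?_
      rw [Real.sqrt_le_left hd0, lseRisk_eq]
      calc ∫ x, lseLoss K σ μ x ^ 2 ∂(stdGaussian (EuclideanSpace ℝ (Fin n)))
          ≤ ∫ _x, d ^ 2 ∂(stdGaussian (EuclideanSpace ℝ (Fin n))) :=
            integral_mono_of_nonneg (.of_forall fun x => sq_nonneg _) (integrable_const _)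
              (.of_forall fun x => pow_le_pow_left₀ (norm_nonneg _) (hloss μ hμ x) 2)
        _ = d ^ 2 := by simp
    nlinarith

/-- A radius that qualifies in the definition of `epsBar` bounds the worst case rate below. -/
theorem le_mul_worstCaseRate (hne : K.Nonempty) (hcl : IsClosed K) (hK : Convex ℝ K)
    {c L σ ε : ℝ} (hc : 1 < c) (hL : c ≤ L) (hσ : 0 < σ) (hε : 0 < ε) (h64 : 64 * σ ≤ ε)
    (hA : L / c * σ ≤ ε)
    (h : 0 ≤ maxWidthGap c K ε - widthConst c * ε ^ 2 / (2 * σ)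
      + L / c * ε * Real.sqrt (localEntropy c K ε)) :
    ε ≤ (8 * c + 4 * L) * worstCaseRate K σ := by
  have hc0 : 0 < c := by linarith
  have hL0 : 0 < L := by linarith
  have hrate : 0 ≤ worstCaseRate K σ := Real.sqrt_nonneg _
  have hC : 8 ≤ widthConst c := by
    rw [widthConst_eq]
    have : 0 < 8 / c := by positivity
    linarith
  -- As `C ≥ 8`, the penalty is at least `4ε²/σ`, so the gap or the entropy term carries `2ε²/σ`.
  have hsplit : 4 * (ε ^ 2 / σ) ≤ widthConst c * ε ^ 2 / (2 * σ) := by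
    calc 4 * (ε ^ 2 / σ) = 8 * ε ^ 2 / (2 * σ) := by field_simp; norm_num
      _ ≤ _ := by gcongr
  have hq : 0 < ε ^ 2 / σ := by positivity
  rcases le_or_gt (2 * (ε ^ 2 / σ)) (maxWidthGap c K ε) with hg | hg
  · obtain ⟨_, ⟨ν₁, h₁, ν₂, h₂, hd, rfl⟩, hlt⟩ := exists_lt_of_lt_csSup
      (nonempty_widthGap hne c hε.le) (show ε ^ 2 / σ < maxWidthGap c K ε by linarith)
    have h1 := le_lseRisk_of_localWidth_sub hcl hK hc hσ h₂ h₁ hε h64 hd hlt.le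
    have h2 := h1.trans (lseRisk_le_worstCaseRate_sq hne hcl hK hσ h₂)
    have h3 : (ε / (8 * c)) ^ 2 ≤ worstCaseRate K σ ^ 2 := by
      refine le_trans (le_of_eq ?_) h2
      field_simp; norm_num
    have h4 := le_of_sq_le_sq h3 hrate
    rw [div_le_iff₀ (by positivity)] at h4
    nlinarith
  · have h1 : 2 * (ε ^ 2 / σ) ≤ L / c * ε * Real.sqrt (localEntropy c K ε) := by linarith
    have h2 : 2 * (c / L * ε / σ) ≤ Real.sqrt (localEntropy c K ε) := by
      refine le_of_mul_le_mul_left (le_trans (le_of_eq ?_) h1) (show 0 < L / c * ε by positivity)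
      field_simp
    have h3 : 4 * (c / L * ε / σ) ^ 2 ≤ localEntropy c K ε := by
      have h4 := Real.le_sqrt' (show 0 < 2 * (c / L * ε / σ) by positivity) |>.1 h2
      linarith
    have h5 : σ ≤ c / L * ε := by
      calc σ = c / L * (L / c * σ) := by field_simp
        _ ≤ _ := by gcongr
    -- The shrinking factor is `c/L`, which offsets the factor `L/c` in front of the entropy term.
    have h6 := le_worstCaseRate_of_localEntropy hne hcl hK hc (by positivity)
      ((div_le_one hL0).2 hL) hσ hε h5 h3
    have h7 : c / L * ε / (4 * c) = ε / (4 * L) := by field_simp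
    rw [h7, div_le_iff₀ (by positivity)] at h6
    nlinarith

end LowerBound

/-! ### Choice of constants and conclusion. -/

theorem theorem2p15 (c : ℝ) (hc : 1 < c) :
    ∃ L₀ : ℝ, 0 < L₀ ∧ ∀ L : ℝ, L₀ ≤ L →
      (∃ A : ℝ, 0 < A ∧ ∃ κ : ℝ, 0 < κ ∧
        ∀ (n : ℕ) (K : Set (EuclideanSpace ℝ (Fin n))), K.Nonempty → IsClosed K → Convex ℝ K →
          ∀ σ : ℝ, 0 < σ → A * σ ≤ epsBar c L K σ →
            epsBar c L K σ / c ≤ κ * worstCaseRate K σ ∧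
            worstCaseRate K σ ≤ epsBar c L K (widthConst c * σ / (1 - 1 / c ^ 2))) ∧
      (∀ B : ℝ, 0 < B → ∃ κ₁ : ℝ, 0 < κ₁ ∧ ∃ κ₂ : ℝ, 0 < κ₂ ∧
        ∀ (n : ℕ) (K : Set (EuclideanSpace ℝ (Fin n))), K.Nonempty → IsClosed K → Convex ℝ K →
          ∀ σ : ℝ, 0 < σ → epsBar c L K (widthConst c * σ / (1 - 1 / c ^ 2)) ≤ B * σ →
            κ₁ * minDiam K σ ≤ worstCaseRate K σ ∧
            worstCaseRate K σ ≤ κ₂ * minDiam K σ) := by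
  have hc0 : 0 < c := by linarith
  have hc1 : 0 < 1 - 1 / c := by
    rw [sub_pos, div_lt_one hc0]; exact hc
  have hcc : 0 < 1 - 1 / c ^ 2 := by
    rw [sub_pos, div_lt_one (by positivity)]; nlinarith
  have hA₁ : 0 < 16 / (1 - 1 / c) ^ 2 := by positivity
  set A₁ := 16 / (1 - 1 / c) ^ 2 with hA₁def
  refine ⟨3 * (c + 1), by linarith, fun L hL => ⟨?_, fun B hB => ?_⟩⟩
  · have hL0 : 0 < L := by linarith
    have hLc : 0 < L / c := by positivity
    refine ⟨A₁ + 128 + 2 * (L / c), by positivity, 2 * (8 * c + 4 * L), by positivity, ?_⟩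
    intro n K hne hcl hK σ hσ hA
    constructor
    · have hA' : 128 * σ + 2 * (L / c * σ) ≤ epsBar c L K σ := by
        refine le_trans ?_ hA
        have := mul_pos hA₁ hσ
        linarith
      have hLσ : 0 < L / c * σ := by positivity
      have hpos : 0 < epsBar c L K σ := by linarith
      -- Attainment of the supremum is not assumed, so a qualifying radius above half of it is used;
      -- this costs the factor `2` in `κ` and in part of `A`.
      obtain ⟨ε, ⟨-, hmem⟩, hlt⟩ := exists_lt_of_lt_csSup (nonempty_epsBar hne c L σ)
        (show epsBar c L K σ / 2 < epsBar c L K σ by linarith)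
      have h := le_mul_worstCaseRate hne hcl hK hc (by linarith) hσ (by linarith)
        (by linarith) (by linarith) hmem
      have h2 : epsBar c L K σ / c ≤ epsBar c L K σ := div_le_self hpos.le hc.le
      linarith
    · have hσσ' : σ ≤ widthConst c * σ / (1 - 1 / c ^ 2) := by
        rw [le_div_iff₀ hcc, widthConst_eq]
        have h1 : 0 < 1 / c ^ 2 := by positivity
        have h2 : 0 < 8 / c := by positivity
        nlinarith [mul_pos hσ h1, mul_pos hσ h2]
      have hmono := epsBar_mono hne hc0 hL0 hσ hσσ'
      have hA' : A₁ * σ ≤ epsBar c L K σ := by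
        refine le_trans ?_ hA
        gcongr
        linarith
      refine worstCaseRate_le hne ?_ fun μ hμ => ?_
      · exact (mul_nonneg hA₁.le hσ.le).trans (hA'.trans hmono)
      · rcases le_total (A₁ * σ) (Real.sqrt (lseRisk K σ μ)) with h | h
        · exact sqrt_lseRisk_le_epsBar hcl hK hc hL hσ hμ h
        · exact h.trans (hA'.trans hmono)
  · refine ⟨1 / 16, by norm_num, A₁ + B + 1, by positivity, ?_⟩
    intro n K hne hcl hK σ hσ hB'
    refine ⟨minDiam_le_worstCaseRate hne hcl hK hσ, ?_⟩
    refine worstCaseRate_le_mul_minDiam hne hcl (by linarith) hσ ?_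
    refine worstCaseRate_le hne (by positivity) fun μ hμ => ?_
    -- Above the threshold `A₁ σ` the root risk is at most `ε̄(σ') ≤ Bσ`; below it the threshold
    -- itself is the bound.
    rcases le_total (A₁ * σ) (Real.sqrt (lseRisk K σ μ)) with h | h
    · refine (sqrt_lseRisk_le_epsBar hcl hK hc hL hσ hμ h).trans (hB'.trans ?_)
      gcongr
      linarith
    · refine h.trans ?_
      gcongr
      linarith
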